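/- Let $n\ge 2$, let $\mathbb{F}_q$ be a finite field, and let $\alpha\in\mathbb{F}_q^\times$ have multiplicative order greater than $n$. Let $B_n$ be the braid group on $n$ strands with Artin generators $s_1,\dots,s_{n-1}$, and let $\mathcal{B}_n$ be its commutator subgroup. For a partition $\lambda\vdash n$ let $V_\lambda$ be the $\mathbb{F}_q$-vector space with basis the standard tableaux of shape $\lambda$, and let $R_\lambda : B_n\to \mathrm{GL}(V_\lambda)$ be the representation (factoring through the Hecke algebra, i.e. $(s_r+1)(s_r-\alpha)=0$) given on a standard tableau $T$ by: * $s_r\cdot T=\alpha T$ if $r$ and $r+1$ lie in the same row of $T$; * $s_r\cdot T=-T$ if $r$ and $r+1$ lie in the same column of $T$; * otherwise $s_r\cdot T=m_r(T)\,T+(1+m_r(T))\,T_{r\leftrightarrow r+1}$, where $T_{r\leftrightarrow r+1}$ is obtained from $T$ by exchanging $r$ and $r+1$, $$m_r(T)=\frac{(\alpha-1)\,ct(T:r+1)}{ct(T:r+1)-ct(T:r)},$$ and $ct(T:m)=-\alpha^{j-i}$ if $m$ lies in row $i$ and column $j$ of $T$. Let $\lambda'$ denote the transpose of $\lambda$.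 Then: 1. For every $\lambda\vdash n$, the restriction of $R_\lambda$ to $\mathcal{B}_n$ is absolutely irreducible. 2. Let $\lambda,\mu\vdash n$ with $\dim V_\lambda>1$ and $\dim V_\mu>1$. If the restrictions of $R_\lambda$ and $R_\mu$ to $\mathcal{B}_n$ are isomorphic, then $\lambda=\mu$. 3. Let $\lambda,\mu\vdash n$ with $\dim V_\lambda>1$ and $\dim V_\mu>1$. If the restrictions to $\mathcal{B}_n$ of $R_\lambda$ and of the dual representation of $R_\mu$ are isomorphic, then $\lambda=\mu'$. -/

import Mathlib

open scoped TensorProduct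

universe u

noncomputable section

/-! ## Braid groups -/

/-- The relations of the Artin presentation on the generators `σ₀, …, σ_{n-2}`. -/
def braidRels (n : ℕ) : Set (FreeGroup (Fin (n - 1))) :=
  {w | ∃ i j : Fin (n - 1), i.val + 1 = j.val ∧
      w = FreeGroup.of i * FreeGroup.of j * FreeGroup.of i *
        (FreeGroup.of j * FreeGroup.of i * FreeGroup.of j)⁻¹} ∪
  {w | ∃ i j : Fin (n - 1), i.val + 1 < j.val ∧
      w = FreeGroup.of i * FreeGroup.of j * (FreeGroup.of j * FreeGroup.of i)⁻¹}

/-- The braid group `B_n` on `n` strands. -/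
abbrev BraidGroup (n : ℕ) : Type := PresentedGroup (braidRels n)

/-- The Artin generator of `B_n`, indexed from `0`. -/
def BraidGroup.σ {n : ℕ} (r : Fin (n - 1)) : BraidGroup n := PresentedGroup.of r

/-! ## Standard tableaux -/

/-- A standard tableau of shape `μ` with entries `0, …, n-1`, given by the map `pos` sending each
entry to the cell (row, column) that contains it.  Entries increase along rows and down columns. -/
@[ext]
structure StdTableau (n : ℕ) (μ : YoungDiagram) where
  pos : Fin n ≃ {c : ℕ × ℕ // c ∈ μ}
  row_lt : ∀ a b : Fin n, (pos a).1.1 = (pos b).1.1 → (pos a).1.2 < (pos b).1.2 → a < b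
  col_lt : ∀ a b : Fin n, (pos a).1.2 = (pos b).1.2 → (pos a).1.1 < (pos b).1.1 → a < b

/-- The smaller of the two entries exchanged by the `r`-th generator. -/
def loEntry {n : ℕ} (r : Fin (n - 1)) : Fin n := ⟨r.val, by omega⟩

/-- The larger of the two entries exchanged by the `r`-th generator. -/
def hiEntry {n : ℕ} (r : Fin (n - 1)) : Fin n := ⟨r.val + 1, by omega⟩

namespace StdTableau

variable {n : ℕ} {μ : YoungDiagram}

/-- The entries `r` and `r+1` lie in the same row. -/
def SameRow (T : StdTableau n μ) (r : Fin (n - 1)) : Prop :=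
  (T.pos (loEntry r)).1.1 = (T.pos (hiEntry r)).1.1

/-- The entries `r` and `r+1` lie in the same column. -/
def SameCol (T : StdTableau n μ) (r : Fin (n - 1)) : Prop :=
  (T.pos (loEntry r)).1.2 = (T.pos (hiEntry r)).1.2

theorem lt_of_swap_lt (r : Fin (n - 1)) (a b : Fin n)
    (h : Equiv.swap (loEntry r) (hiEntry r) a < Equiv.swap (loEntry r) (hiEntry r) b)
    (hne : ¬ (Equiv.swap (loEntry r) (hiEntry r) a = loEntry r ∧
      Equiv.swap (loEntry r) (hiEntry r) b = hiEntry r)) : a < b := by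
  simp only [Equiv.swap_apply_def, loEntry, hiEntry, Fin.ext_iff, Fin.lt_def] at *
  split_ifs at * <;> simp_all <;> omega

/-- The tableau obtained by exchanging `r` and `r+1`, when these are neither in the same row nor in
the same column. -/
def swap (T : StdTableau n μ) (r : Fin (n - 1)) (hr : ¬ T.SameRow r) (hc : ¬ T.SameCol r) :
    StdTableau n μ where
  pos := (Equiv.swap (loEntry r) (hiEntry r)).trans T.pos
  row_lt a b h1 h2 := lt_of_swap_lt r a b (T.row_lt _ _ h1 h2) fun h => hr <| by
    simpa [SameRow, h.1, h.2] using h1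
  col_lt a b h1 h2 := lt_of_swap_lt r a b (T.col_lt _ _ h1 h2) fun h => hc <| by
    simpa [SameCol, h.1, h.2] using h1

end StdTableau

/-! ## The seminormal (Hoefsmit) matrix model -/

section Model

variable {k : Type*} [Field k] {n : ℕ} {μ : YoungDiagram}

/-- The value `-α^(j-i)` attached to the cell in row `i` and column `j`. -/
def ctCell (α : kˣ) (c : ℕ × ℕ) : k := -((α ^ ((c.2 : ℤ) - (c.1 : ℤ)) : kˣ) : k)

/-- `(α-1) ct(d) / (ct(d) - ct(c))`. -/
def mCell (α : kˣ) (c d : ℕ × ℕ) : k :=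
  ((α : k) - 1) * ctCell α d / (ctCell α d - ctCell α c)

/-- The coefficient `m_r(T)`. -/
def mCoeff (α : kˣ) (T : StdTableau n μ) (r : Fin (n - 1)) : k :=
  mCell α (T.pos (loEntry r)).1 (T.pos (hiEntry r)).1

open Classical in
/-- The image of the standard tableau `T` under the `r`-th generator. -/
def heckeVec (α : kˣ) (r : Fin (n - 1)) (T : StdTableau n μ) : StdTableau n μ →₀ k :=
  if hr : T.SameRow r then Finsupp.single T (α : k)
  else if hc : T.SameCol r then Finsupp.single T (-1)
  else Finsupp.single T (mCoeff α T r) + Finsupp.single (T.swap r hr hc) (1 + mCoeff α T r)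

/-- The space `V_μ` with basis the standard tableaux of shape `μ`. -/
abbrev SpechtSpace (k : Type*) [Field k] (n : ℕ) (μ : YoungDiagram) : Type _ :=
  StdTableau n μ →₀ k

/-- The operator on `V_μ` by which the `r`-th generator acts. -/
def heckeOp (α : kˣ) (μ : YoungDiagram) (r : Fin (n - 1)) : Module.End k (SpechtSpace k n μ) :=
  Finsupp.linearCombination k (heckeVec α r)

/-! ### The defining relations, checked on arbitrary (not necessarily standard) fillings -/

section Formal

variable {C : Type*} (m b : C → C → k)

/-- Auxiliary operator on the space spanned by all bijective fillings. -/
def formalOp (i j : Fin n) : Module.End k ((Fin n ≃ C) →₀ k) :=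
  Finsupp.linearCombination k fun P =>
    Finsupp.single P (m (P i) (P j)) + Finsupp.single ((Equiv.swap i j).trans P) (b (P i) (P j))

theorem formalOp_single (i j : Fin n) (P : Fin n ≃ C) :
    formalOp m b i j (Finsupp.single P 1) = m (P i) (P j) • Finsupp.single P (1 : k) +
      b (P i) (P j) • Finsupp.single ((Equiv.swap i j).trans P) (1 : k) := by
  simp [formalOp]

theorem formalOp_sq (i j : Fin n) (P : Fin n ≃ C) (a : k)
    (h1 : m (P i) (P j) * m (P i) (P j) + b (P i) (P j) * b (P j) (P i)
      = (a - 1) * m (P i) (P j) + a)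
    (h2 : m (P i) (P j) + m (P j) (P i) = a - 1) :
    formalOp m b i j (formalOp m b i j (Finsupp.single P 1)) =
      (a - 1) • formalOp m b i j (Finsupp.single P 1) + a • Finsupp.single P 1 := by
  have e : (Equiv.swap i j).trans ((Equiv.swap i j).trans P) = P := by
    ext x; simp
  simp only [formalOp_single, map_add, map_smul, e, Equiv.trans_apply, Equiv.swap_apply_left,
    Equiv.swap_apply_right]
  generalize Finsupp.single P (1 : k) = A
  generalize Finsupp.single ((Equiv.swap i j).trans P) (1 : k) = B
  linear_combination (norm := module) h1 • A + b (P i) (P j) • h2 • B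

theorem formalOp_comm (i j p q : Fin n) (h1 : i ≠ p) (h2 : i ≠ q) (h3 : j ≠ p) (h4 : j ≠ q)
    (P : Fin n ≃ C) :
    formalOp m b i j (formalOp m b p q (Finsupp.single P 1)) =
      formalOp m b p q (formalOp m b i j (Finsupp.single P 1)) := by
  have e : (Equiv.swap i j).trans ((Equiv.swap p q).trans P)
      = (Equiv.swap p q).trans ((Equiv.swap i j).trans P) := by
    ext x
    simp only [Equiv.trans_apply, Equiv.swap_apply_def]
    split_ifs <;> simp_all
  simp only [formalOp_single, map_add, map_smul, e, Equiv.trans_apply,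
    Equiv.swap_apply_of_ne_of_ne h1 h2, Equiv.swap_apply_of_ne_of_ne h3 h4,
    Equiv.swap_apply_of_ne_of_ne h1.symm h3.symm, Equiv.swap_apply_of_ne_of_ne h2.symm h4.symm]
  module

theorem formalOp_braid (i j l : Fin n) (hij : i ≠ j) (hil : i ≠ l) (hjl : j ≠ l)
    (P : Fin n ≃ C)
    (h1 : m (P i) (P j) * m (P j) (P l) * m (P i) (P j) +
        b (P i) (P j) * m (P i) (P l) * b (P j) (P i) =
      m (P j) (P l) * m (P i) (P j) * m (P j) (P l) +
        b (P j) (P l) * m (P i) (P l) * b (P l) (P j))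
    (h2 : m (P i) (P j) * m (P j) (P l) + m (P i) (P l) * m (P j) (P i) =
      m (P j) (P l) * m (P i) (P l))
    (h3 : m (P i) (P j) * m (P i) (P l) =
      m (P j) (P l) * m (P i) (P j) + m (P i) (P l) * m (P l) (P j)) :
    formalOp m b i j (formalOp m b j l (formalOp m b i j (Finsupp.single P 1))) =
      formalOp m b j l (formalOp m b i j (formalOp m b j l (Finsupp.single P 1))) := by
  have e0 : (Equiv.swap i j).trans ((Equiv.swap i j).trans P) = P := by
    ext x; simp
  have e1 : (Equiv.swap j l).trans ((Equiv.swap j l).trans P) = P := by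
    ext x; simp
  have e2 : (Equiv.swap i j).trans ((Equiv.swap j l).trans ((Equiv.swap i j).trans P))
      = (Equiv.swap j l).trans ((Equiv.swap i j).trans ((Equiv.swap j l).trans P)) := by
    ext x
    simp only [Equiv.trans_apply, Equiv.swap_apply_def]
    split_ifs <;> simp_all
  simp only [formalOp_single, map_add, map_smul, e0, e1, e2, Equiv.trans_apply,
    Equiv.swap_apply_left, Equiv.swap_apply_right,
    Equiv.swap_apply_of_ne_of_ne hij hil, Equiv.swap_apply_of_ne_of_ne hil.symm hjl.symm]
  generalize Finsupp.single P (1 : k) = A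
  generalize Finsupp.single ((Equiv.swap i j).trans P) (1 : k) = B
  generalize Finsupp.single ((Equiv.swap j l).trans P) (1 : k) = D
  linear_combination (norm := module) h1 • A + b (P i) (P j) • h2 • B + b (P j) (P l) • h3 • D

end Formal

/-! ### Contents in standard tableaux -/

namespace StdTableau

theorem card_eq (T : StdTableau n μ) : μ.card = n := by
  have h := Nat.card_congr T.pos
  rw [Nat.card_fin] at h
  rw [h]
  exact (Nat.subtype_card μ.cells fun c => YoungDiagram.mem_cells c).symm

theorem _root_.YoungDiagram.mem_of_le {c d : ℕ × ℕ} (h1 : c.1 ≤ d.1) (h2 : c.2 ≤ d.2)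
    (hd : d ∈ μ) : c ∈ μ :=
  μ.up_left_mem h1 h2 hd

theorem exists_entry (T : StdTableau n μ) {c : ℕ × ℕ} (hc : c ∈ μ) :
    ∃ a : Fin n, (T.pos a).1 = c :=
  ⟨T.pos.symm ⟨c, hc⟩, by simp⟩

theorem pos_inj (T : StdTableau n μ) {a b : Fin n} (h1 : (T.pos a).1.1 = (T.pos b).1.1)
    (h2 : (T.pos a).1.2 = (T.pos b).1.2) : a = b :=
  T.pos.injective (Subtype.ext (Prod.ext h1 h2))

theorem lt_of_le (T : StdTableau n μ) {a b : Fin n} (h1 : (T.pos a).1.1 ≤ (T.pos b).1.1)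
    (h2 : (T.pos a).1.2 ≤ (T.pos b).1.2) : a ≤ b := by
  have hmem : ((T.pos a).1.1, (T.pos b).1.2) ∈ μ :=
    YoungDiagram.mem_of_le h1 le_rfl (T.pos b).2
  obtain ⟨c, hc⟩ := T.exists_entry hmem
  have hac : a ≤ c := by
    rcases h2.eq_or_lt with h | h
    · exact (T.pos_inj (by simp [hc]) (by simp [hc, h])).le
    · exact (T.row_lt a c (by simp [hc]) (by simpa [hc] using h)).le
  have hcb : c ≤ b := by
    rcases h1.eq_or_lt with h | h
    · exact (T.pos_inj (by simp [hc, h]) (by simp [hc])).le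
    · exact (T.col_lt c b (by simp [hc]) (by simpa [hc] using h)).le
  exact hac.trans hcb

theorem row_adjacent (T : StdTableau n μ) {a b : Fin n} (hab : a.val + 1 = b.val)
    (h : (T.pos a).1.1 = (T.pos b).1.1) : (T.pos b).1.2 = (T.pos a).1.2 + 1 := by
  rcases lt_trichotomy (T.pos a).1.2 (T.pos b).1.2 with h' | h' | h'
  · by_contra hne
    have hmem : ((T.pos a).1.1, (T.pos a).1.2 + 1) ∈ μ :=
      YoungDiagram.mem_of_le h.le (by dsimp only; omega) (T.pos b).2
    obtain ⟨c, hc⟩ := T.exists_entry hmem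
    have h1 := T.row_lt a c (by simp [hc]) (by simp [hc])
    have h2 := T.row_lt c b (by simp [hc, h]) (by simp only [hc]; omega)
    rw [Fin.lt_def] at h1 h2
    omega
  · have := T.pos_inj h h'
    rw [this] at hab; omega
  · have := T.row_lt b a h.symm h'
    rw [Fin.lt_def] at this; omega

theorem col_adjacent (T : StdTableau n μ) {a b : Fin n} (hab : a.val + 1 = b.val)
    (h : (T.pos a).1.2 = (T.pos b).1.2) : (T.pos b).1.1 = (T.pos a).1.1 + 1 := by
  rcases lt_trichotomy (T.pos a).1.1 (T.pos b).1.1 with h' | h' | h'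
  · by_contra hne
    have hmem : ((T.pos a).1.1 + 1, (T.pos a).1.2) ∈ μ :=
      YoungDiagram.mem_of_le (by dsimp only; omega) h.le (T.pos b).2
    obtain ⟨c, hc⟩ := T.exists_entry hmem
    have h1 := T.col_lt a c (by simp [hc]) (by simp [hc])
    have h2 := T.col_lt c b (by simp [hc, h]) (by simp only [hc]; omega)
    rw [Fin.lt_def] at h1 h2
    omega
  · have := T.pos_inj h' h
    rw [this] at hab; omega
  · have := T.col_lt b a h.symm h'
    rw [Fin.lt_def] at this; omega

/-- Two distinct entries on a common diagonal differ by at least `3`. -/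
theorem diagonal_gap (T : StdTableau n μ) {a b : Fin n} (hab : a < b)
    (h : ((T.pos a).1.2 : ℤ) - (T.pos a).1.1 = (T.pos b).1.2 - (T.pos b).1.1) :
    a.val + 3 ≤ b.val := by
  have hlt : (T.pos a).1.1 < (T.pos b).1.1 := by
    by_contra hle
    have := T.lt_of_le (a := b) (b := a) (by omega) (by omega)
    exact absurd hab (not_lt.mpr this)
  have hm1 : ((T.pos a).1.1, (T.pos a).1.2 + 1) ∈ μ :=
    YoungDiagram.mem_of_le (by dsimp only; omega) (by dsimp only; omega) (T.pos b).2
  have hm2 : ((T.pos a).1.1 + 1, (T.pos a).1.2) ∈ μ :=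
    YoungDiagram.mem_of_le (by dsimp only; omega) (by dsimp only; omega) (T.pos b).2
  obtain ⟨c, hc⟩ := T.exists_entry hm1
  obtain ⟨d, hd⟩ := T.exists_entry hm2
  have h1 := T.row_lt a c (by simp [hc]) (by simp [hc])
  have h2 := T.col_lt a d (by simp [hd]) (by simp [hd])
  have h3 : c ≤ b := T.lt_of_le (by simp only [hc]; omega) (by simp only [hc]; omega)
  have h4 : d ≤ b := T.lt_of_le (by simp only [hd]; omega) (by simp only [hd]; omega)
  have h5 : c ≠ d := by
    rintro rfl
    rw [hc] at hd
    simp at hd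
  have h6 : c ≠ b := by
    rintro rfl
    simp only [hc] at hlt
    omega
  have h7 : d ≠ b := by
    rintro rfl
    simp only [hd] at h
    omega
  simp only [Fin.lt_def, Fin.le_def, ne_eq, Fin.ext_iff] at *
  omega

end StdTableau

theorem hook_le_card {c d : ℕ × ℕ} (hc : c ∈ μ) (hd : d ∈ μ) : c.2 + d.1 + 1 ≤ μ.card := by
  let f : ℕ → ℕ × ℕ := fun x => if x ≤ c.2 then (0, x) else (x - c.2, 0)
  have hinj : Set.InjOn f (Finset.range (c.2 + d.1 + 1)) := by
    intro x _ y _ hxy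
    simp only [f] at hxy
    split_ifs at hxy <;> simp only [Prod.mk.injEq] at hxy <;> omega
  have hsub : (Finset.range (c.2 + d.1 + 1)).image f ⊆ μ.cells := by
    intro p hp
    obtain ⟨x, hx, rfl⟩ := Finset.mem_image.mp hp
    rw [Finset.mem_range] at hx
    rw [YoungDiagram.mem_cells]
    simp only [f]
    split_ifs with h
    · exact μ.up_left_mem (Nat.zero_le _) h hc
    · exact μ.up_left_mem (by omega) (Nat.zero_le _) hd
  have := Finset.card_le_card hsub
  rwa [Finset.card_image_of_injOn hinj, Finset.card_range] at this

theorem ctCell_ne (α : kˣ) (hα : n < orderOf α) (hμ : μ.card = n) {c d : ℕ × ℕ} (hc : c ∈ μ)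
    (hd : d ∈ μ) (h : (c.2 : ℤ) - c.1 ≠ d.2 - d.1) : ctCell α c ≠ ctCell α d := by
  intro heq
  have h1 : α ^ ((c.2 : ℤ) - c.1) = α ^ ((d.2 : ℤ) - d.1) := by
    apply Units.ext
    simpa [ctCell] using heq
  have h2 := orderOf_dvd_sub_iff_zpow_eq_zpow.mpr h1
  have h3 := hook_le_card hc hd
  have h4 := hook_le_card hd hc
  have h5 := Int.eq_zero_of_abs_lt_dvd h2 (by rw [abs_lt]; constructor <;> omega)
  omega

open Classical in
/-- Off-diagonal coefficient, `0` for cells in a common row or column. -/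
def bCell (α : kˣ) (c d : ℕ × ℕ) : k :=
  if c.1 = d.1 ∨ c.2 = d.2 then 0 else 1 + mCell α c d

theorem mCell_add (α : kˣ) {c d : ℕ × ℕ} (h : ctCell α c ≠ ctCell α d) :
    mCell α c d + mCell α d c = (α : k) - 1 := by
  have h1 := sub_ne_zero.mpr h
  have h2 := sub_ne_zero.mpr h.symm
  unfold mCell
  field_simp
  ring

theorem ctCell_ne_zero (α : kˣ) (c : ℕ × ℕ) : ctCell α c ≠ 0 := by
  rw [ctCell, neg_ne_zero]
  exact Units.ne_zero _

theorem ctCell_succ (α : kˣ) {c d : ℕ × ℕ} (h : (d.2 : ℤ) - d.1 = c.2 - c.1 + 1) :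
    ctCell α d = α * ctCell α c := by
  simp only [ctCell, h, zpow_add, zpow_one, Units.val_mul]
  ring

theorem mCell_succ (α : kˣ) {c d : ℕ × ℕ} (hne : ctCell α c ≠ ctCell α d)
    (h : (d.2 : ℤ) - d.1 = c.2 - c.1 + 1) : mCell α c d = α := by
  have h1 := sub_ne_zero.mpr hne.symm
  unfold mCell
  rw [div_eq_iff h1, ctCell_succ α h]
  ring

theorem mCell_pred (α : kˣ) {c d : ℕ × ℕ} (hne : ctCell α c ≠ ctCell α d)
    (h : (c.2 : ℤ) - c.1 = d.2 - d.1 + 1) : mCell α c d = -1 := by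
  have := mCell_add α hne
  rw [mCell_succ α hne.symm h] at this
  linear_combination this

theorem bCell_mul (α : kˣ) {c d : ℕ × ℕ} (hne : ctCell α c ≠ ctCell α d)
    (hadj : c.1 = d.1 ∨ c.2 = d.2 →
      (d.2 : ℤ) - d.1 = c.2 - c.1 + 1 ∨ (c.2 : ℤ) - c.1 = d.2 - d.1 + 1) :
    bCell α c d * bCell α d c = α + mCell α c d * mCell α d c := by
  have hadd := mCell_add α hne
  by_cases h : c.1 = d.1 ∨ c.2 = d.2
  · have h0 : bCell α c d = 0 := by simp [bCell, h]
    rw [h0]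
    rcases hadj h with h' | h'
    · rw [mCell_succ α hne h', mCell_pred α hne.symm h']; ring
    · rw [mCell_pred α hne h', mCell_succ α hne.symm h']; ring
  · have h' : ¬ (d.1 = c.1 ∨ d.2 = c.2) := by rwa [eq_comm, @eq_comm _ d.2]
    simp only [bCell, h, h', if_false]
    linear_combination hadd

theorem mCell_braid₁ (α : kˣ) {c d e : ℕ × ℕ} (h1 : ctCell α c ≠ ctCell α d)
    (h2 : ctCell α c ≠ ctCell α e) (h3 : ctCell α d ≠ ctCell α e) :
    mCell α c d * mCell α d e + mCell α c e * mCell α d c = mCell α d e * mCell α c e := by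
  have g1 := sub_ne_zero.mpr h1
  have g1' := sub_ne_zero.mpr h1.symm
  have g2 := sub_ne_zero.mpr h2.symm
  have g3 := sub_ne_zero.mpr h3.symm
  unfold mCell
  field_simp
  ring

theorem mCell_braid₂ (α : kˣ) {c d e : ℕ × ℕ} (h1 : ctCell α c ≠ ctCell α d)
    (h2 : ctCell α c ≠ ctCell α e) (h3 : ctCell α d ≠ ctCell α e) :
    mCell α c d * mCell α c e = mCell α d e * mCell α c d + mCell α c e * mCell α e d := by
  have g1 := sub_ne_zero.mpr h1.symm
  have g2 := sub_ne_zero.mpr h2.symm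
  have g3 := sub_ne_zero.mpr h3
  have g3' := sub_ne_zero.mpr h3.symm
  unfold mCell
  field_simp
  ring

theorem mCell_braid₃ (α : kˣ) {c d e : ℕ × ℕ} (h1 : ctCell α c ≠ ctCell α d)
    (h2 : ctCell α c ≠ ctCell α e) (h3 : ctCell α d ≠ ctCell α e) :
    mCell α c d * mCell α d e * mCell α c d + mCell α c e * (α + mCell α c d * mCell α d c) =
      mCell α d e * mCell α c d * mCell α d e +
        mCell α c e * (α + mCell α d e * mCell α e d) := by
  linear_combination mCell α c d * mCell_braid₁ α h1 h2 h3 +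
    mCell α d e * mCell_braid₂ α h1 h2 h3

namespace StdTableau

theorem pos_injective : Function.Injective (pos : StdTableau n μ → _) :=
  fun _ _ h => StdTableau.ext h

theorem ctCell_ne_of_near (α : kˣ) (hα : n < orderOf α) (T : StdTableau n μ) {a b : Fin n}
    (hab : a < b) (hb : b.val < a.val + 3) :
    ctCell α (T.pos a).1 ≠ ctCell α (T.pos b).1 := by
  refine ctCell_ne α hα T.card_eq (T.pos a).2 (T.pos b).2 fun h => ?_
  have := T.diagonal_gap hab h
  omega

theorem bCell_mul_of_succ (α : kˣ) (hα : n < orderOf α) (T : StdTableau n μ) {a b : Fin n}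
    (hab : a.val + 1 = b.val) :
    bCell α (T.pos a).1 (T.pos b).1 * bCell α (T.pos b).1 (T.pos a).1 =
      α + mCell α (T.pos a).1 (T.pos b).1 * mCell α (T.pos b).1 (T.pos a).1 := by
  refine bCell_mul α (T.ctCell_ne_of_near α hα (by rw [Fin.lt_def]; omega) (by omega)) ?_
  rintro (h | h)
  · have := T.row_adjacent hab h
    left; omega
  · have := T.col_adjacent hab h
    right; omega

end StdTableau

/-- `formalOp` with the coefficients of the model. -/
def cellOp (α : kˣ) (μ : YoungDiagram) (r : Fin (n - 1)) :
    Module.End k ((Fin n ≃ {c : ℕ × ℕ // c ∈ μ}) →₀ k) :=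
  formalOp (fun c d => mCell α c.1 d.1) (fun c d => bCell α c.1 d.1) (loEntry r) (hiEntry r)

/-- The inclusion of standard tableaux into all bijective fillings, extended linearly. -/
def tabIncl (k : Type*) [Field k] (n : ℕ) (μ : YoungDiagram) :
    SpechtSpace k n μ →ₗ[k] ((Fin n ≃ {c : ℕ × ℕ // c ∈ μ}) →₀ k) :=
  Finsupp.lmapDomain k k StdTableau.pos

theorem tabIncl_injective : Function.Injective (tabIncl k n μ) :=
  Finsupp.mapDomain_injective StdTableau.pos_injective

theorem tabIncl_single (T : StdTableau n μ) (x : k) :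
    tabIncl k n μ (Finsupp.single T x) = Finsupp.single T.pos x := by
  simp [tabIncl]

theorem tabIncl_heckeOp (α : kˣ) (hα : n < orderOf α) (r : Fin (n - 1)) (v : SpechtSpace k n μ) :
    tabIncl k n μ (heckeOp α μ r v) = cellOp α μ r (tabIncl k n μ v) := by
  suffices h : tabIncl k n μ ∘ₗ heckeOp α μ r = cellOp α μ r ∘ₗ tabIncl k n μ from
    LinearMap.congr_fun h v
  ext1 T
  ext1
  have hab : (loEntry r).val + 1 = (hiEntry r).val := rfl
  have hne := T.ctCell_ne_of_near α hα (a := loEntry r) (b := hiEntry r)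
    (by rw [Fin.lt_def]; omega) (by omega)
  simp only [LinearMap.comp_apply, Finsupp.lsingle_apply, tabIncl_single, cellOp, formalOp_single,
    heckeOp, Finsupp.linearCombination_single, one_smul, heckeVec]
  split_ifs with hr hc
  · have h := T.row_adjacent hab hr
    unfold StdTableau.SameRow at hr
    rw [mCell_succ α hne (by omega), tabIncl_single]
    simp [bCell, hr]
  · have h := T.col_adjacent hab hc
    unfold StdTableau.SameCol at hc
    rw [mCell_pred α hne (by omega), tabIncl_single]
    simp [bCell, hc]
  · have h' : ¬ ((T.pos (loEntry r)).1.1 = (T.pos (hiEntry r)).1.1 ∨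
      (T.pos (loEntry r)).1.2 = (T.pos (hiEntry r)).1.2) := not_or.mpr ⟨hr, hc⟩
    rw [map_add, tabIncl_single, tabIncl_single]
    simp [bCell, h', mCoeff, StdTableau.swap]

theorem heckeOp_sq (α : kˣ) (hα : n < orderOf α) (r : Fin (n - 1)) :
    heckeOp α μ r * heckeOp α μ r = ((α : k) - 1) • heckeOp α μ r + (α : k) • 1 := by
  ext1 T
  ext1
  apply tabIncl_injective
  simp only [LinearMap.comp_apply, Module.End.mul_apply, LinearMap.add_apply, LinearMap.smul_apply,
    Module.End.one_apply, map_add, map_smul, tabIncl_heckeOp α hα, Finsupp.lsingle_apply,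
    tabIncl_single]
  have hab : (loEntry r).val + 1 = (hiEntry r).val := rfl
  have hne := T.ctCell_ne_of_near α hα (a := loEntry r) (b := hiEntry r)
    (by rw [Fin.lt_def]; omega) (by omega)
  have h1 := mCell_add α hne
  apply formalOp_sq _ _ _ _ _ _ _ h1
  rw [T.bCell_mul_of_succ α hα hab]
  linear_combination mCell α (T.pos (loEntry r)).1 (T.pos (hiEntry r)).1 * h1

theorem heckeOp_braid (α : kˣ) (hα : n < orderOf α) (r s : Fin (n - 1))
    (hrs : r.val + 1 = s.val) :
    heckeOp α μ r * heckeOp α μ s * heckeOp α μ r =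
      heckeOp α μ s * heckeOp α μ r * heckeOp α μ s := by
  ext1 T
  ext1
  apply tabIncl_injective
  simp only [LinearMap.comp_apply, Module.End.mul_apply, tabIncl_heckeOp α hα,
    Finsupp.lsingle_apply, tabIncl_single]
  have hs : hiEntry r = loEntry s := Fin.ext hrs
  have v1 : (loEntry r).val + 1 = (loEntry s).val := hrs
  have v2 : (loEntry s).val + 1 = (hiEntry s).val := rfl
  unfold cellOp
  rw [hs]
  have n1 := T.ctCell_ne_of_near α hα (a := loEntry r) (b := loEntry s)
    (by rw [Fin.lt_def]; omega) (by omega)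
  have n2 := T.ctCell_ne_of_near α hα (a := loEntry r) (b := hiEntry s)
    (by rw [Fin.lt_def]; omega) (by omega)
  have n3 := T.ctCell_ne_of_near α hα (a := loEntry s) (b := hiEntry s)
    (by rw [Fin.lt_def]; omega) (by omega)
  have b1 := T.bCell_mul_of_succ α hα v1
  have b2 := T.bCell_mul_of_succ α hα v2
  apply formalOp_braid
  · rw [ne_eq, Fin.ext_iff]; omega
  · rw [ne_eq, Fin.ext_iff]; omega
  · rw [ne_eq, Fin.ext_iff]; omega
  · have b3 := mCell_braid₃ α n1 n2 n3
    rw [← b1, ← b2] at b3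
    linear_combination b3
  · exact mCell_braid₁ α n1 n2 n3
  · exact mCell_braid₂ α n1 n2 n3

theorem heckeOp_comm (α : kˣ) (hα : n < orderOf α) (r s : Fin (n - 1))
    (hrs : r.val + 1 < s.val) :
    heckeOp α μ r * heckeOp α μ s = heckeOp α μ s * heckeOp α μ r := by
  ext1 T
  ext1
  apply tabIncl_injective
  simp only [LinearMap.comp_apply, Module.End.mul_apply, tabIncl_heckeOp α hα,
    Finsupp.lsingle_apply, tabIncl_single]
  apply formalOp_comm <;>
  · simp only [loEntry, hiEntry, ne_eq, Fin.ext_iff]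
    omega

/-! ### The representations `R_μ` -/

theorem quadratic_mul_inv {A : Type*} [Ring A] [Algebra k A] (α : kˣ) (S : A)
    (h : S * S = ((α : k) - 1) • S + (α : k) • (1 : A)) :
    S * ((α⁻¹ : kˣ) : k) • (S - ((α : k) - 1) • (1 : A)) = 1 := by
  rw [mul_smul_comm, mul_sub, h, mul_smul_comm, mul_one, add_sub_cancel_left,
    smul_smul, Units.inv_mul, one_smul]

theorem quadratic_inv_mul {A : Type*} [Ring A] [Algebra k A] (α : kˣ) (S : A)
    (h : S * S = ((α : k) - 1) • S + (α : k) • (1 : A)) :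
    ((α⁻¹ : kˣ) : k) • (S - ((α : k) - 1) • (1 : A)) * S = 1 := by
  rw [smul_mul_assoc, sub_mul, h, smul_mul_assoc, one_mul, add_sub_cancel_left,
    smul_smul, Units.inv_mul, one_smul]

/-- The action of the `r`-th generator, as an invertible operator. -/
def heckeUnit (α : kˣ) (hα : n < orderOf α) (μ : YoungDiagram) (r : Fin (n - 1)) :
    (Module.End k (SpechtSpace k n μ))ˣ where
  val := heckeOp α μ r
  inv := ((α⁻¹ : kˣ) : k) • (heckeOp α μ r - ((α : k) - 1) • 1)
  val_inv := quadratic_mul_inv (A := Module.End k (SpechtSpace k n μ)) α _ (heckeOp_sq α hα r)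
  inv_val := quadratic_inv_mul (A := Module.End k (SpechtSpace k n μ)) α _ (heckeOp_sq α hα r)

theorem heckeUnit_rels (α : kˣ) (hα : n < orderOf α) (μ : YoungDiagram) :
    ∀ w ∈ braidRels n, FreeGroup.lift (heckeUnit α hα μ) w = 1 := by
  rintro w (⟨i, j, hij, rfl⟩ | ⟨i, j, hij, rfl⟩)
  · simp only [map_mul, map_inv, FreeGroup.lift_apply_of]
    rw [mul_inv_eq_one]
    exact Units.ext (heckeOp_braid α hα i j hij)
  · simp only [map_mul, map_inv, FreeGroup.lift_apply_of]
    rw [mul_inv_eq_one]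
    exact Units.ext (heckeOp_comm α hα i j hij)

/-- The representation `R_μ` of `B_n` on `V_μ`, in which the Artin generators act by `heckeOp`. -/
def heckeRep (α : kˣ) (hα : n < orderOf α) (μ : YoungDiagram) :
    Representation k (BraidGroup n) (SpechtSpace k n μ) :=
  (Units.coeHom _).comp (PresentedGroup.toGroup (heckeUnit_rels α hα μ))

theorem heckeRep_σ (α : kˣ) (hα : n < orderOf α) (μ : YoungDiagram) (r : Fin (n - 1)) :
    heckeRep α hα μ (BraidGroup.σ r) = heckeOp α μ r := by
  simp [heckeRep, BraidGroup.σ, heckeUnit]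

end Model

/-! ## Representations of the commutator subgroup -/

/-- The restriction of a representation of `G` to the commutator subgroup of `G`. -/
def Representation.resCommutator {k G V : Type*} [CommSemiring k] [Group G] [AddCommMonoid V]
    [Module k V] (ρ : Representation k G V) : Representation k (commutator G) V :=
  ρ.comp (commutator G).subtype

/-- Extension of scalars of a representation from `k` to `K`. -/
def Representation.extendScalars {k G V : Type*} (K : Type*) [Field k] [Field K] [Algebra k K]
    [Group G] [AddCommGroup V] [Module k V] (ρ : Representation k G V) :
    Representation K G (K ⊗[k] V) :=
  (Module.End.baseChangeHom k K V : Module.End k V →* Module.End K (K ⊗[k] V)).comp ρ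

/-- A representation is absolutely irreducible if it is irreducible over every extension field.
(The universe of `k` contains an algebraic closure of `k`.) -/
def Representation.IsAbsolutelyIrreducible {k : Type u} {G V : Type*} [Field k] [Group G]
    [AddCommGroup V] [Module k V] (ρ : Representation k G V) : Prop :=
  ∀ (K : Type u) [Field K] [Algebra k K], (ρ.extendScalars K).IsIrreducible

end

/-! ## Subalgebras normalised by a quadratic element -/

section QuadraticElement

variable {k M : Type*} [Field k] [Ring M] [Algebra k M]

/-! The tableau basis diagonalises the Jucys–Murphy operators, with the contents `-α^(j-i)` as
eigenvalues. Since `α` has order greater than `n`, contents separate standard tableaux, even of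
different shapes (`pos_eq_of_ctCell_eq`). Polynomials in these operators therefore project onto the
basis lines. Admissible exchanges connect all tableaux of one shape with nonzero coefficients, so
every matrix unit arises and the Artin generators generate `End V` (`adjoin_heckeOp_eq_top`).

To descend to the commutator subgroup, let `A` be the algebra its image generates and let `s` be one
generator, which may be assumed non-scalar. All generators agree modulo commutators, so `End V = A +
A s`, and `s` normalises `A`. Conjugation by `s` fixes the diagonal blocks for the two eigenspaces
of `s` and scales the off-diagonal ones by `-α` and `-α⁻¹`. As `α² ≠ 1`, each off-diagonal block can
be isolated inside `A`, and simplicity of `End V` forces `A = End V`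
(`Subalgebra.eq_top_of_normalized`). Absolute irreducibility follows.

An isomorphism of restrictions intertwines each generator up to a scalar `c`, by a Schur argument.
Comparing quadratic relations gives `c = 1`, or `c = -α` for a dual. The isomorphism then matches
Jucys–Murphy operators, so the contents of a tableau of one shape are those of a tableau of the
other shape. For a dual the eigenvalues are inverse contents, which are the contents of the
transposed tableau. -/

theorem isSimpleRing_end (V : Type*) [AddCommGroup V] [Module k V] [FiniteDimensional k V]
    [Nontrivial V] : IsSimpleRing (Module.End k V) := by
  have : Nonempty (Fin (Module.finrank k V)) := ⟨⟨0, Module.finrank_pos⟩⟩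
  exact IsSimpleRing.of_ringEquiv (algEquivMatrix (Module.finBasis k V)).symm.toRingEquiv
    inferInstance

/-- If `p`, `q` are nonzero with `p + q` invertible, `p ^ 2` a multiple of `p`, and a subalgebra of a
simple algebra contains `p M q` and `q M p`, then it is everything. -/
theorem Subalgebra.eq_top_of_corners [IsSimpleRing M] (A : Subalgebra k M) {p q : M} {c : k}
    (hc : c ≠ 0) (hp : p ≠ 0) (hq : q ≠ 0) (hpq : p + q = c • 1)
    (hpp : p * p = c • p) (hqq : q * q = c • q)
    (h₁ : ∀ m, p * m * q ∈ A) (h₂ : ∀ m, q * m * p ∈ A) : A = ⊤ := by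
  have key : ∀ {p q : M}, q ≠ 0 → q * q = c • q → (∀ m, p * m * q ∈ A) → (∀ m, q * m * p ∈ A) →
      ∀ x, p * x * p ∈ A := by
    intro p q hq hqq h₁ h₂ x
    -- The ideal of all `x` with `p M x M p ⊆ A`. It contains `q ≠ 0`, because `(p m q)(q m' p)` is
    -- `c` times `p m q m' p`; by simplicity it contains `1`.
    let I : TwoSidedIdeal M := TwoSidedIdeal.mk' {x | ∀ m m', p * m * x * m' * p ∈ A}
      (fun m m' => by simp)
      (fun {x y} hx hy m m' => by
        have := A.add_mem (hx m m') (hy m m')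
        simpa only [mul_add, add_mul] using this)
      (fun {x} hx m m' => by
        have := A.neg_mem (hx m m')
        simpa only [mul_neg, neg_mul] using this)
      (fun {x y} hy m m' => by simpa only [mul_assoc] using hy (m * x) m')
      (fun {x y} hx m m' => by simpa only [mul_assoc] using hx m (y * m'))
    have hmem : ∀ x, x ∈ I ↔ ∀ m m', p * m * x * m' * p ∈ A := fun x => by
      simp only [I, TwoSidedIdeal.mem_mk', Set.mem_ofPred_eq]
    have hqI : q ∈ I := by
      rw [hmem]
      intro m m'
      have h := A.smul_mem (A.mul_mem (h₁ m) (h₂ m')) c⁻¹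
      have e : p * m * q * (q * m' * p) = c • (p * m * q * m' * p) := by
        calc p * m * q * (q * m' * p) = p * m * (q * q) * m' * p := by simp only [mul_assoc]
          _ = _ := by rw [hqq]; simp only [mul_smul_comm, smul_mul_assoc]
      rwa [e, smul_smul, inv_mul_cancel₀ hc, one_smul] at h
    have htop : I = ⊤ := by
      refine (eq_bot_or_eq_top I).resolve_left fun h => hq ?_
      rwa [h, TwoSidedIdeal.mem_bot] at hqI
    have h1 : (1 : M) ∈ I := by rw [htop]; trivial
    simpa using (hmem 1).mp h1 x 1
  rw [eq_top_iff]
  intro x _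
  -- Up to the factor `c²`, `x` is the sum of its four corners.
  have e : (p + q) * x * (p + q) = (c * c) • x := by
    rw [hpq]; simp [smul_smul]
  have h : (p + q) * x * (p + q) ∈ A := by
    have := A.add_mem (A.add_mem (key hq hqq h₁ h₂ x) (h₁ x))
      (A.add_mem (h₂ x) (key hp hpp h₂ h₁ x))
    convert this using 1
    noncomm_ring
  rw [e] at h
  have := A.smul_mem h (c * c)⁻¹
  rwa [smul_smul, inv_mul_cancel₀ (mul_ne_zero hc hc), one_smul] at this

/-- A subalgebra `A` of a simple algebra that is normalised by a non-scalar `s` with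
`(s + 1)(s - a) = 0`, and generates the algebra together with `s`, is everything. -/
theorem Subalgebra.eq_top_of_normalized [IsSimpleRing M] (A : Subalgebra k M) {s t : M} {a : k}
    (ha0 : a ≠ 0) (ha : a * a ≠ 1) (hs : s * s = (a - 1) • s + a • 1)
    (ht : t = a⁻¹ • (s - (a - 1) • 1))
    (hA₁ : ∀ x ∈ A, s * x * t ∈ A) (hA₂ : ∀ x ∈ A, t * x * s ∈ A)
    (hgen : ∀ m, ∃ x ∈ A, ∃ y ∈ A, m = x + y * s)
    (hns : ∀ c : k, s ≠ c • 1) : A = ⊤ := by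
  have ha1 : a + 1 ≠ 0 := fun h => ha (by linear_combination (a - 1) * h)
  have haa : a ^ 2 - 1 ≠ 0 := sub_ne_zero.mpr (by rwa [sq])
  -- `x - s x t` and `x - t x s` have no diagonal blocks; on the two off-diagonal blocks they carry
  -- the factors `1 + a`, `1 + a⁻¹` and these interchanged. The combination below eliminates one
  -- block, which needs `a² ≠ 1`.
  have h₁ : ∀ x ∈ A, (s + 1) * x * (a • 1 - s) ∈ A := by
    intro x hx
    have h := A.smul_mem (A.sub_mem (A.smul_mem (A.sub_mem hx (hA₁ x hx)) (1 + a))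
      (A.smul_mem (A.sub_mem hx (hA₂ x hx)) (1 + a⁻¹))) (a ^ 2 * (a ^ 2 - 1)⁻¹)
    convert h using 1
    simp only [ht, mul_sub, sub_mul, add_mul, mul_smul_comm, smul_mul_assoc, mul_one, one_mul]
    match_scalars <;> field_simp <;> ring
  have h₂ : ∀ x ∈ A, (a • 1 - s) * x * (s + 1) ∈ A := by
    intro x hx
    have h := A.smul_mem (A.sub_mem (A.smul_mem (A.sub_mem hx (hA₂ x hx)) (1 + a))
      (A.smul_mem (A.sub_mem hx (hA₁ x hx)) (1 + a⁻¹))) (a ^ 2 * (a ^ 2 - 1)⁻¹)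
    convert h using 1
    simp only [ht, mul_sub, sub_mul, mul_add, mul_smul_comm, smul_mul_assoc, mul_one,
      one_mul]
    match_scalars <;> field_simp <;> ring
  have e₁ : s * (a • 1 - s) = -(a • 1 - s) := by
    rw [mul_sub, hs, mul_smul_comm, mul_one]; module
  have e₂ : s * (s + 1) = a • (s + 1) := by
    rw [mul_add, hs, mul_one]; module
  refine A.eq_top_of_corners (p := s + 1) (q := a • 1 - s) ha1 ?_ ?_
    (by rw [add_smul, one_smul]; abel) ?_ ?_ ?_ ?_
  · intro h
    exact hns (-1) (by rw [eq_neg_of_add_eq_zero_left h]; module)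
  · intro h
    exact hns a (sub_eq_zero.mp h).symm
  · rw [add_mul, e₂, one_mul]; module
  · rw [sub_mul, e₁, smul_mul_assoc, one_mul]; module
  -- On the range of `a - s`, `s` acts as `-1`, so `x + y s` may be replaced by `x - y ∈ A`. In the
  -- other corner `s` acts as `a`.
  · intro m
    obtain ⟨x, hx, y, hy, rfl⟩ := hgen m
    have := h₁ _ (A.sub_mem hx hy)
    convert this using 1
    rw [mul_assoc, add_mul x, mul_assoc y, e₁, mul_assoc (s + 1), sub_mul x, mul_neg,
      ← sub_eq_add_neg]
  · intro m
    obtain ⟨x, hx, y, hy, rfl⟩ := hgen m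
    have := h₂ _ (A.add_mem hx (A.smul_mem hy a))
    convert this using 1
    rw [mul_assoc, add_mul x, mul_assoc y, e₂, mul_assoc _ (x + a • y), add_mul x, mul_smul_comm,
      smul_mul_assoc]

end QuadraticElement

/-! ## Representations whose image generates the endomorphism algebra -/

section Generation

variable {G V : Type*} [Group G] [AddCommGroup V]

/-- A subrepresentation over `K` is stable under the base change of every endomorphism over `k`.
Rank-one operators suffice: they carry a vector with a nonzero coordinate to a nonzero multiple of
any basis vector. -/
theorem Representation.isAbsolutelyIrreducible_of_adjoin_eq_top {k : Type u} [Field k] [Module k V]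
    [Nontrivial V] (ρ : Representation k G V)
    (h : Algebra.adjoin k (Set.range ρ) = ⊤) : ρ.IsAbsolutelyIrreducible := by
  intro K _ _
  let b := Module.Basis.ofVectorSpace k V
  let B := b.baseChange K
  have hstab : ∀ (W : Subrepresentation (ρ.extendScalars K)) (f : Module.End k V),
      ∀ w ∈ W.toSubmodule, f.baseChange K w ∈ W.toSubmodule := by
    intro W f
    have hf : f ∈ Algebra.adjoin k (Set.range ρ) := by rw [h]; trivial
    induction hf using Algebra.adjoin_induction with
    | mem x hx =>
      obtain ⟨g, rfl⟩ := hx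
      exact fun w hw => W.apply_mem_toSubmodule g hw
    | algebraMap r =>
      intro w hw
      have e : (algebraMap k (Module.End k V) r).baseChange K w = algebraMap k K r • w := by
        rw [Algebra.algebraMap_eq_smul_one, LinearMap.baseChange_smul]
        simp
      rw [e]
      exact W.toSubmodule.smul_mem _ hw
    | add x y _ _ hx hy =>
      intro w hw
      rw [LinearMap.baseChange_add]
      exact W.toSubmodule.add_mem (hx w hw) (hy w hw)
    | mul x y _ _ hx hy =>
      intro w hw
      rw [LinearMap.baseChange_mul]
      exact hx _ (hy w hw)
  have : Nontrivial (K ⊗[k] V) := by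
    obtain ⟨i⟩ := b.index_nonempty
    exact ⟨⟨B i, 0, B.ne_zero i⟩⟩
  refine { exists_pair_ne := ⟨⊥, ⊤, fun e => ?_⟩, eq_bot_or_eq_top := fun W => ?_ }
  · exact bot_ne_top (α := Submodule K (K ⊗[k] V)) (congrArg Subrepresentation.toSubmodule e)
  · by_cases hW : W.toSubmodule = ⊥
    · left
      exact Subrepresentation.toSubmodule_injective hW
    right
    apply Subrepresentation.toSubmodule_injective
    obtain ⟨w, hw, hw0⟩ := Submodule.exists_mem_ne_zero_of_ne_bot hW
    obtain ⟨i, hi⟩ : ∃ i, B.repr w i ≠ 0 := by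
      by_contra! hall
      exact hw0 (B.repr.map_eq_zero_iff.mp (Finsupp.ext hall))
    change W.toSubmodule = ⊤
    rw [eq_top_iff, ← B.span_eq, Submodule.span_le]
    rintro _ ⟨j, rfl⟩
    have e : ((b.coord i).smulRight (b j)).baseChange K = (B.coord i).smulRight (B j) := by
      ext v
      simp [B, TensorProduct.smul_tmul']
    have := hstab W ((b.coord i).smulRight (b j)) w hw
    rw [e, LinearMap.smulRight_apply, Module.Basis.coord_apply] at this
    exact (W.toSubmodule.smul_mem_iff hi).mp this

end Generation

/-! ## Combinatorics of standard tableaux -/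

namespace StdTableau

variable {n : ℕ} {μ ν : YoungDiagram}

instance : Finite (StdTableau n μ) :=
  have : Finite {c : ℕ × ℕ // c ∈ μ} := μ.cells.finite_toSet
  Finite.of_injective pos pos_injective

/-- The tableau with the entries filled in along the rows. -/
theorem nonempty_of_card (h : μ.card = n) : Nonempty (StdTableau n μ) := by
  -- Lexicographic order on cells increases along rows and down columns, so its enumeration is a
  -- standard tableau.
  let s : Finset (ℕ ×ₗ ℕ) := μ.cells.map toLex.toEmbedding
  have hs : s.card = n := by rw [Finset.card_map]; exact h
  let e := s.orderIsoOfFin hs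
  let f : s ≃ {c : ℕ × ℕ // c ∈ μ} := ofLex.subtypeEquiv fun c => by
    simp [s, YoungDiagram.mem_cells]
  have hf : ∀ a, (f (e a)).1 = ofLex (e a).1 := fun a => rfl
  refine ⟨⟨e.toEquiv.trans f, fun a b h₁ h₂ => ?_, fun a b h₁ h₂ => ?_⟩⟩
  · rw [← e.lt_iff_lt, ← Subtype.coe_lt_coe, Prod.Lex.lt_iff]
    exact Or.inr ⟨h₁, h₂⟩
  · rw [← e.lt_iff_lt, ← Subtype.coe_lt_coe, Prod.Lex.lt_iff]
    exact Or.inl h₂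

/-- The transposed tableau. -/
def transpose (T : StdTableau n μ) : StdTableau n μ.transpose where
  pos := T.pos.trans ((Equiv.prodComm ℕ ℕ).subtypeEquiv fun c => by
    simp [YoungDiagram.mem_transpose])
  row_lt a b h₁ h₂ := T.col_lt a b h₁ h₂
  col_lt a b h₁ h₂ := T.row_lt a b h₁ h₂

theorem transpose_pos (T : StdTableau n μ) (a : Fin n) :
    (T.transpose.pos a).1 = (T.pos a).1.swap := rfl

theorem pos_zero (T : StdTableau n μ) (a : Fin n) (ha : a.val = 0) : (T.pos a).1 = (0, 0) := by
  obtain ⟨b, hb⟩ := T.exists_entry (c := (0, 0))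
    (YoungDiagram.mem_of_le (Nat.zero_le _) (Nat.zero_le _) (T.pos a).2)
  have h := T.lt_of_le (a := b) (b := a) (by simp [hb]) (by simp [hb])
  have : b = a := Fin.ext (by rw [Fin.le_def] at h; omega)
  rw [← this, hb]

/-! ### Contents determine a standard tableau -/

section Separation

variable (T : StdTableau n μ) (U : StdTableau n ν) {a : Fin n}

/-- The hook bound does not apply directly to cells of two different shapes. But the cell just above
that of `a` in `U` holds a smaller entry, so it also lies in the shape of `T`; the hook bound there
gives `n`, which is still below the order of `α`. -/
theorem col_add_row_le (h : ∀ b < a, (T.pos b).1 = (U.pos b).1) :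
    (T.pos a).1.2 + (U.pos a).1.1 ≤ n := by
  have hn := T.card_eq
  rcases Nat.eq_zero_or_pos (U.pos a).1.1 with h0 | h0
  · have := hook_le_card (T.pos a).2 (T.pos a).2
    omega
  · obtain ⟨b, hb⟩ := U.exists_entry (c := ((U.pos a).1.1 - 1, (U.pos a).1.2))
      (YoungDiagram.mem_of_le (Nat.sub_le _ _) le_rfl (U.pos a).2)
    have hba : b < a := U.col_lt b a (by simp [hb]) (by simp only [hb]; omega)
    have hT := h b hba
    have := hook_le_card (T.pos a).2 (T.pos b).2
    rw [hT, hb] at this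
    dsimp only at this
    omega

/-- The cell of `a` in `T` lies weakly north-west of its cell in `U`, hence carries some `b ≤ a` in
`U`. If `b < a`, agreement on smaller entries would put both `a` and `b` in that cell of `T`. -/
theorem pos_eq_of_diag (h : ∀ b < a, (T.pos b).1 = (U.pos b).1)
    (hd : ((T.pos a).1.2 : ℤ) - (T.pos a).1.1 = (U.pos a).1.2 - (U.pos a).1.1)
    (hle : (T.pos a).1.1 ≤ (U.pos a).1.1) : (T.pos a).1 = (U.pos a).1 := by
  obtain ⟨b, hb⟩ := U.exists_entry (c := (T.pos a).1)
    (YoungDiagram.mem_of_le hle (by omega) (U.pos a).2)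
  have hba : b ≤ a := U.lt_of_le (by rw [hb]; exact hle) (by rw [hb]; omega)
  rcases hba.eq_or_lt with rfl | hlt
  · exact hb.symm
  · have h₁ := (h b hlt).trans hb
    have : b = a := T.pos.injective (Subtype.ext h₁)
    exact absurd hlt (this ▸ lt_irrefl _)

/-- A standard tableau, including its shape, is determined by its contents modulo the order
of `α`. -/
theorem pos_eq_of_ctCell_eq {k : Type*} [Field k] (α : kˣ) (hα : n < orderOf α)
    (h : ∀ a, ctCell α (T.pos a).1 = ctCell α (U.pos a).1) (a : Fin n) :
    (T.pos a).1 = (U.pos a).1 := by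
  induction a using WellFoundedLT.induction with
  | _ a ih =>
    have h₁ := col_add_row_le T U ih
    have h₂ := col_add_row_le U T fun b hb => (ih b hb).symm
    have hz : α ^ (((T.pos a).1.2 : ℤ) - (T.pos a).1.1) =
        α ^ (((U.pos a).1.2 : ℤ) - (U.pos a).1.1) :=
      Units.ext (by simpa [ctCell] using h a)
    have hdvd := orderOf_dvd_sub_iff_zpow_eq_zpow.mpr hz
    -- The two bounds make the difference of exponents at most `n` in absolute value, so
    -- divisibility by the order of `α` forces it to vanish.
    have h0 := Int.eq_zero_of_abs_lt_dvd hdvd (by rw [abs_lt]; constructor <;> omega)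
    rcases le_total (T.pos a).1.1 (U.pos a).1.1 with hle | hle
    · exact pos_eq_of_diag T U ih (by omega) hle
    · exact (pos_eq_of_diag U T (fun b hb => (ih b hb).symm) (by omega) hle).symm

theorem shape_eq_of_ctCell_eq {k : Type*} [Field k] (α : kˣ) (hα : n < orderOf α)
    (h : ∀ a, ctCell α (T.pos a).1 = ctCell α (U.pos a).1) : μ = ν := by
  have hp := pos_eq_of_ctCell_eq T U α hα h
  refine YoungDiagram.ext (Finset.ext fun c => ?_)
  rw [YoungDiagram.mem_cells, YoungDiagram.mem_cells]
  constructor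
  · intro hc
    obtain ⟨a, rfl⟩ := T.exists_entry hc
    rw [hp]
    exact (U.pos a).2
  · intro hc
    obtain ⟨a, rfl⟩ := U.exists_entry hc
    rw [← hp]
    exact (T.pos a).2

end Separation

/-- Any two standard tableaux of the same shape are connected by admissible exchanges. -/
theorem reflTransGen_swap (T U : StdTableau n μ) :
    Relation.ReflTransGen (fun T T' : StdTableau n μ => ∃ r hr hc, T' = T.swap r hr hc) T U := by
  let R := fun T T' : StdTableau n μ => ∃ r hr hc, T' = T.swap r hr hc
  let w : StdTableau n μ → Fin n → Fin n := fun T a => U.pos.symm (T.pos a)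
  -- As in the rearrangement inequality, exchanging `r` and `r+1` across a descent of `w` increases
  -- `f` by the size of the descent. Such an exchange is admissible: neighbours in a row or column
  -- are increasing in `U`, so they form no descent. At a maximum `w` is thus monotone, hence the
  -- identity.
  let f : StdTableau n μ → ℕ := fun T => ∑ a : Fin n, a.val * (w T a).val
  obtain ⟨T', hT', hmax⟩ := Set.exists_max_image {T' | Relation.ReflTransGen R T T'} f
    (Set.toFinite _) ⟨T, .refl⟩
  suffices h : T' = U from h ▸ hT'
  have hmono : ∀ r : Fin (n - 1), w T' (loEntry r) < w T' (hiEntry r) := by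
    intro r
    by_contra hle
    have hU : ∀ a, U.pos (w T' a) = T'.pos a := fun a => by simp [w]
    have hr : ¬ T'.SameRow r := fun h => by
      have h₁ := T'.row_adjacent (a := loEntry r) (b := hiEntry r) rfl h
      exact hle (U.row_lt _ _ (by rw [hU, hU]; exact h) (by rw [hU, hU]; omega))
    have hc : ¬ T'.SameCol r := fun h => by
      have h₁ := T'.col_adjacent (a := loEntry r) (b := hiEntry r) rfl h
      exact hle (U.col_lt _ _ (by rw [hU, hU]; exact h) (by rw [hU, hU]; omega))
    have hlt : w T' (hiEntry r) < w T' (loEntry r) := by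
      refine lt_of_le_of_ne (not_lt.mp hle) fun h => ?_
      have := T'.pos.injective (U.pos.symm.injective h)
      simp [loEntry, hiEntry] at this
    have hne : loEntry r ≠ hiEntry r := by simp [loEntry, hiEntry]
    have hw : ∀ a, w (T'.swap r hr hc) a = w T' (Equiv.swap (loEntry r) (hiEntry r) a) :=
      fun a => rfl
    have := hmax (T'.swap r hr hc) (hT'.tail ⟨r, hr, hc, rfl⟩)
    refine absurd this (not_le.mpr ?_)
    simp only [f]
    rw [← Finset.add_sum_erase _ _ (Finset.mem_univ (loEntry r)),
      ← Finset.add_sum_erase _ _ (Finset.mem_erase.mpr ⟨hne.symm, Finset.mem_univ (hiEntry r)⟩),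
      ← Finset.add_sum_erase (a := loEntry r) _ (fun a => a.val * (w (T'.swap r hr hc) a).val)
        (Finset.mem_univ (loEntry r)),
      ← Finset.add_sum_erase (a := hiEntry r) _ (fun a => a.val * (w (T'.swap r hr hc) a).val)
        (Finset.mem_erase.mpr ⟨hne.symm, Finset.mem_univ (hiEntry r)⟩)]
    have hsum : ∑ a ∈ (Finset.univ.erase (loEntry r)).erase (hiEntry r),
        a.val * (w (T'.swap r hr hc) a).val =
        ∑ a ∈ (Finset.univ.erase (loEntry r)).erase (hiEntry r), a.val * (w T' a).val := by
      refine Finset.sum_congr rfl fun a ha => ?_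
      simp only [Finset.mem_erase, Finset.mem_univ, and_true] at ha
      rw [hw, Equiv.swap_apply_of_ne_of_ne ha.2 ha.1]
    rw [hsum, hw, hw, Equiv.swap_apply_left, Equiv.swap_apply_right]
    rw [Fin.lt_def] at hlt
    have e₁ : (hiEntry r).val = (loEntry r).val + 1 := rfl
    rw [e₁]
    nlinarith
  have hmono' : StrictMono (w T') := by
    cases n with
    | zero => exact fun a => a.elim0
    | succ n => exact Fin.strictMono_iff_lt_succ.mpr hmono
  have hid : w T' = id := hmono'.eq_id
  apply pos_injective
  ext1 a
  have := congrFun hid a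
  rwa [id, Equiv.symm_apply_eq] at this

end StdTableau

/-! ## Restriction to the commutator subgroup -/

section Commutator

variable {k G V W ι : Type*} [Field k] [Group G] [AddCommGroup V] [Module k V]
  [AddCommGroup W] [Module k W]

theorem Representation.conj_mem_adjoin_resCommutator (ρ : Representation k G V) (g : G)
    {x : Module.End k V} (hx : x ∈ Algebra.adjoin k (Set.range ρ.resCommutator)) :
    ρ g * x * ρ g⁻¹ ∈ Algebra.adjoin k (Set.range ρ.resCommutator) := by
  have hg : ρ g⁻¹ * ρ g = 1 := by rw [← map_mul, inv_mul_cancel, map_one]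
  have hg' : ρ g * ρ g⁻¹ = 1 := by rw [← map_mul, mul_inv_cancel, map_one]
  induction hx using Algebra.adjoin_induction with
  | mem x hx =>
    obtain ⟨h, rfl⟩ := hx
    refine Algebra.subset_adjoin ⟨⟨g * h.1 * g⁻¹, ?_⟩, ?_⟩
    · exact Subgroup.Normal.conj_mem inferInstance _ h.2 g
    · simp [Representation.resCommutator]
  | algebraMap r =>
    rw [← Algebra.commutes, mul_assoc, hg', mul_one]
    exact Subalgebra.algebraMap_mem _ r
  | add x y _ _ hx hy =>
    rw [mul_add, add_mul]
    exact Subalgebra.add_mem _ hx hy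
  | mul x y _ _ hx hy =>
    have e : ρ g * (x * y) * ρ g⁻¹ = (ρ g * x * ρ g⁻¹) * (ρ g * y * ρ g⁻¹) := by
      calc ρ g * (x * y) * ρ g⁻¹ = ρ g * x * 1 * y * ρ g⁻¹ := by simp only [mul_assoc, one_mul]
        _ = _ := by rw [← hg]; simp only [mul_assoc]
    rw [e]
    exact Subalgebra.mul_mem _ hx hy

/-- If elements that agree modulo the commutator subgroup act by operators with
`(s + 1)(s - a) = 0` that generate the endomorphism algebra, then the commutator subgroup also
generates it. -/
theorem Representation.adjoin_resCommutator_eq_top [FiniteDimensional k V] [Nontrivial V]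
    (ρ : Representation k G V) (σ : ι → G) (i₀ : ι)
    (hσ : ∀ i, σ i * (σ i₀)⁻¹ ∈ commutator G) {a : k} (ha0 : a ≠ 0) (ha : a * a ≠ 1)
    (hs : ρ (σ i₀) * ρ (σ i₀) = (a - 1) • ρ (σ i₀) + a • 1)
    (hgen : Algebra.adjoin k (Set.range fun i => ρ (σ i)) = ⊤) :
    Algebra.adjoin k (Set.range ρ.resCommutator) = ⊤ := by
  have := isSimpleRing_end (k := k) V
  set A := Algebra.adjoin k (Set.range ρ.resCommutator)
  have hσA : ∀ i, ρ (σ i * (σ i₀)⁻¹) ∈ A := fun i => Algebra.subset_adjoin ⟨⟨_, hσ i⟩, rfl⟩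
  have hσe : ∀ i, ρ (σ i) = ρ (σ i * (σ i₀)⁻¹) * ρ (σ i₀) := fun i => by
    rw [← map_mul, inv_mul_cancel_right]
  have hts : ρ (σ i₀)⁻¹ * ρ (σ i₀) = 1 := by rw [← map_mul, inv_mul_cancel, map_one]
  -- If `s` is scalar, every generator is already a scalar multiple of an element of `A`.
  by_cases hns : ∃ c : k, ρ (σ i₀) = c • 1
  · obtain ⟨c, hc⟩ := hns
    rw [eq_top_iff, ← hgen, Algebra.adjoin_le_iff]
    rintro _ ⟨i, rfl⟩
    dsimp only
    rw [hσe i, hc, mul_smul_comm, mul_one]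
    exact A.smul_mem (hσA i) c
  push Not at hns
  have hconj : ∀ x ∈ A, ρ (σ i₀) * x * ρ (σ i₀)⁻¹ ∈ A := fun x hx =>
    ρ.conj_mem_adjoin_resCommutator _ hx
  refine A.eq_top_of_normalized ha0 ha hs (t := ρ (σ i₀)⁻¹) ?_ hconj ?_ ?_ hns
  · refine left_inv_eq_right_inv hts ?_
    exact quadratic_mul_inv (Units.mk0 a ha0) _ hs
  · intro x hx
    have := ρ.conj_mem_adjoin_resCommutator (σ i₀)⁻¹ hx
    rwa [inv_inv] at this
  · have hcomm : ∀ x, ρ (σ i₀) * x = ρ (σ i₀) * x * ρ (σ i₀)⁻¹ * ρ (σ i₀) := fun x => by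
      rw [mul_assoc _ (ρ (σ i₀)⁻¹), hts, mul_one]
    -- `A + A s` is closed under products: `s y = (s y s⁻¹) s` moves `s` to the right, and the
    -- quadratic relation reduces `s²`.
    let N : Subalgebra k (Module.End k V) :=
      { carrier := {m | ∃ x ∈ A, ∃ y ∈ A, m = x + y * ρ (σ i₀)}
        mul_mem' := by
          rintro _ _ ⟨x, hx, y, hy, rfl⟩ ⟨x', hx', y', hy', rfl⟩
          refine ⟨x * x' + a • (y * (ρ (σ i₀) * y' * ρ (σ i₀)⁻¹)), ?_,
            x * y' + y * (ρ (σ i₀) * x' * ρ (σ i₀)⁻¹) +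
              (a - 1) • (y * (ρ (σ i₀) * y' * ρ (σ i₀)⁻¹)), ?_, ?_⟩
          · exact A.add_mem (A.mul_mem hx hx') (A.smul_mem (A.mul_mem hy (hconj _ hy')) _)
          · exact A.add_mem (A.add_mem (A.mul_mem hx hy') (A.mul_mem hy (hconj _ hx')))
              (A.smul_mem (A.mul_mem hy (hconj _ hy')) _)
          · have e₁ : y * ρ (σ i₀) * x' = y * (ρ (σ i₀) * x' * ρ (σ i₀)⁻¹) * ρ (σ i₀) := by
              conv_lhs => rw [mul_assoc y, hcomm, ← mul_assoc y]
            have e₂ : y * ρ (σ i₀) * (y' * ρ (σ i₀)) =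
                (a - 1) • (y * (ρ (σ i₀) * y' * ρ (σ i₀)⁻¹)) * ρ (σ i₀) +
                  a • (y * (ρ (σ i₀) * y' * ρ (σ i₀)⁻¹)) := by
              calc y * ρ (σ i₀) * (y' * ρ (σ i₀))
                  = y * (ρ (σ i₀) * y') * ρ (σ i₀) := by simp only [mul_assoc]
                _ = y * (ρ (σ i₀) * y' * ρ (σ i₀)⁻¹) * (ρ (σ i₀) * ρ (σ i₀)) := by
                  conv_lhs => rw [hcomm y']
                  simp only [mul_assoc]
                _ = _ := by
                  rw [hs, mul_add, mul_smul_comm, mul_smul_comm, mul_one, smul_mul_assoc]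
            rw [add_mul, mul_add, mul_add, e₁, e₂, add_mul, add_mul, mul_assoc x y']
            abel
        add_mem' := by
          rintro _ _ ⟨x, hx, y, hy, rfl⟩ ⟨x', hx', y', hy', rfl⟩
          exact ⟨_, A.add_mem hx hx', _, A.add_mem hy hy', by rw [add_mul]; abel⟩
        algebraMap_mem' := fun r => ⟨_, A.algebraMap_mem r, 0, A.zero_mem, by simp⟩ }
    have hN : N = ⊤ := by
      rw [eq_top_iff, ← hgen, Algebra.adjoin_le_iff]
      rintro _ ⟨i, rfl⟩
      exact ⟨0, A.zero_mem, _, hσA i, by rw [zero_add]; exact hσe i⟩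
    intro m
    have : m ∈ N := by rw [hN]; trivial
    exact this

/-- An isomorphism between the restrictions to the commutator subgroup intertwines the original
representations up to scalars. -/
theorem Representation.exists_smul_of_resCommutator_equiv [FiniteDimensional k V]
    (ρ : Representation k G V) (τ : Representation k G W)
    (hgen : Algebra.adjoin k (Set.range ρ.resCommutator) = ⊤) (φ : V ≃ₗ[k] W)
    (hφ : ∀ h ∈ commutator G, ∀ v, φ (ρ h v) = τ h (φ v)) (g : G) :
    ∃ c : k, ∀ v, φ (ρ g v) = c • τ g (φ v) := by
  -- By normality, `u` commutes with the commutator subgroup, hence with all of `End V`, and so is a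
  -- scalar.
  let u : Module.End k V := φ.symm.toLinearMap ∘ₗ τ g⁻¹ ∘ₗ φ.toLinearMap ∘ₗ ρ g
  have hu : ∀ v, u v = φ.symm (τ g⁻¹ (φ (ρ g v))) := fun v => rfl
  have hcomm : ∀ x : Module.End k V, x * u = u * x := by
    intro x
    have hx : x ∈ Algebra.adjoin k (Set.range ρ.resCommutator) := by rw [hgen]; trivial
    induction hx using Algebra.adjoin_induction with
    | mem x hx =>
      obtain ⟨⟨h, hh⟩, rfl⟩ := hx
      ext v
      change ρ h (u v) = u (ρ h v)
      have e₁ : ρ g (ρ h v) = ρ (g * h * g⁻¹) (ρ g v) := by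
        rw [← Module.End.mul_apply, ← map_mul, ← Module.End.mul_apply, ← map_mul,
          inv_mul_cancel_right]
      have e₂ : ∀ w, τ g⁻¹ (τ (g * h * g⁻¹) w) = τ h (τ g⁻¹ w) := fun w => by
        rw [← Module.End.mul_apply, ← map_mul, ← Module.End.mul_apply, ← map_mul]
        congr 2
        group
      apply φ.injective
      rw [hφ h hh, hu, hu, e₁, hφ _ (Subgroup.Normal.conj_mem inferInstance _ hh g), e₂,
        φ.apply_symm_apply, φ.apply_symm_apply]
    | algebraMap r => exact Algebra.commutes r u
    | add x y _ _ hx hy => rw [add_mul, mul_add, hx, hy]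
    | mul x y _ _ hx hy => rw [mul_assoc, hy, ← mul_assoc, hx, mul_assoc]
  have hcen : u ∈ Submonoid.center (Module.End k V) := Submonoid.mem_center_iff.mpr hcomm
  obtain ⟨c, hc, huc⟩ := Module.End.mem_submonoidCenter_iff.mp hcen
  refine ⟨c, fun v => ?_⟩
  have h₁ : u v = c • v := by rw [huc]; rfl
  have h₂ : τ g (φ (u v)) = φ (ρ g v) := by
    rw [hu, φ.apply_symm_apply, ← Module.End.mul_apply, ← map_mul, mul_inv_cancel, map_one]
    rfl
  rw [← h₂, h₁, map_smul, map_smul]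

end Commutator

/-! ## The abelianization of the braid group -/

namespace BraidGroup

variable {n : ℕ}

theorem σ_braid (i j : Fin (n - 1)) (h : i.val + 1 = j.val) :
    (σ i * σ j * σ i : BraidGroup n) = σ j * σ i * σ j := by
  have := PresentedGroup.one_of_mem (rels := braidRels n) (Or.inl ⟨i, j, h, rfl⟩)
  rw [map_mul, map_inv, mul_inv_eq_one] at this
  rwa [map_mul, map_mul, map_mul, map_mul] at this

/-- In a commutative group `s t s = t s t` cancels to `s = t`. -/
theorem abelianization_of_σ (i : Fin (n - 1)) (h0 : 0 < n - 1) :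
    Abelianization.of (σ i : BraidGroup n) = Abelianization.of (σ ⟨0, h0⟩) := by
  obtain ⟨i, hi⟩ := i
  induction i with
  | zero => rfl
  | succ i ih =>
    rw [← ih (by omega)]
    have h := congrArg Abelianization.of (σ_braid ⟨i, by omega⟩ ⟨i + 1, hi⟩ rfl)
    simp only [map_mul] at h
    rw [mul_comm (Abelianization.of (σ ⟨i + 1, hi⟩)), mul_assoc, mul_assoc, mul_left_cancel_iff,
      mul_comm, mul_right_cancel_iff] at h
    exact h.symm

theorem σ_mul_inv_mem_commutator (i : Fin (n - 1)) (h0 : 0 < n - 1) :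
    σ i * (σ ⟨0, h0⟩)⁻¹ ∈ commutator (BraidGroup n) := by
  rw [← Abelianization.ker_of, MonoidHom.mem_ker, map_mul, map_inv, mul_inv_eq_one]
  exact abelianization_of_σ i h0

end BraidGroup

/-! ## The Jucys–Murphy operators and generation of the endomorphism algebra -/

section Generation

variable {k : Type*} [Field k] {n : ℕ} {μ : YoungDiagram}

instance : FiniteDimensional k (SpechtSpace k n μ) :=
  Module.Finite.of_basis Finsupp.basisSingleOne

/-- The operator acting on every standard tableau `T` by the scalar `f T`. -/
noncomputable def diagOp (f : StdTableau n μ → k) : Module.End k (SpechtSpace k n μ) :=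
  Finsupp.linearCombination k fun T => Finsupp.single T (f T)

theorem diagOp_single (f : StdTableau n μ → k) (T : StdTableau n μ) (x : k) :
    diagOp f (Finsupp.single T x) = f T • Finsupp.single T x := by
  simp [diagOp, mul_comm]

theorem diagOp_apply (f : StdTableau n μ → k) (v : SpechtSpace k n μ) (T : StdTableau n μ) :
    diagOp f v T = f T * v T := by
  induction v using Finsupp.induction_linear with
  | zero => simp
  | add v w hv hw => rw [map_add, Finsupp.add_apply, hv, hw, Finsupp.add_apply, mul_add]
  | single U x =>
    rw [diagOp_single, Finsupp.smul_apply, smul_eq_mul]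
    by_cases h : U = T
    · rw [h]
    · simp [Finsupp.single_eq_of_ne' h]

/-- `diagOp` as an algebra homomorphism. -/
noncomputable def diagHom : (StdTableau n μ → k) →ₐ[k] Module.End k (SpechtSpace k n μ) where
  toFun := diagOp
  map_one' := by ext1 T; ext1; simp [diagOp_single]
  map_mul' f g := by
    refine LinearMap.ext fun v => Finsupp.ext fun T => ?_
    simp [diagOp_apply, mul_assoc]
  map_zero' := by
    refine LinearMap.ext fun v => Finsupp.ext fun T => ?_
    simp [diagOp_apply]
  map_add' f g := by
    refine LinearMap.ext fun v => Finsupp.ext fun T => ?_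
    simp [diagOp_apply, add_mul]
  commutes' r := by
    refine LinearMap.ext fun v => Finsupp.ext fun T => ?_
    simp [diagOp_apply, Algebra.algebraMap_eq_smul_one]

/-- The Jucys–Murphy operator attached to the entry `a`, up to sign. -/
noncomputable def contentOp (α : kˣ) (μ : YoungDiagram) (a : Fin n) :
    Module.End k (SpechtSpace k n μ) :=
  diagOp fun T => ctCell α (T.pos a).1

theorem contentOp_zero (α : kˣ) (a : Fin n) (ha : a.val = 0) : contentOp α μ a = (-1 : k) • 1 := by
  refine LinearMap.ext fun v => Finsupp.ext fun T => ?_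
  simp [contentOp, diagOp_apply, T.pos_zero a ha, ctCell]

/-- The summands are opposite, with common numerator `(α-1) ct(c) ct(d)`. This identity removes the
off-diagonal term in the Jucys–Murphy recursion. -/
theorem mCell_mul_ctCell (α : kˣ) {c d : ℕ × ℕ} (h : ctCell α c ≠ ctCell α d) :
    mCell α c d * ctCell α c + mCell α d c * ctCell α d = 0 := by
  have h₁ := sub_ne_zero.mpr h
  have h₂ := sub_ne_zero.mpr h.symm
  unfold mCell
  field_simp
  ring

/-- The Jucys–Murphy recursion. It makes the diagonal content operators words in the generators, so
that they lie in the generated algebra and are carried along by intertwiners. -/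
theorem heckeOp_contentOp (α : kˣ) (hα : n < orderOf α) (r : Fin (n - 1)) :
    heckeOp α μ r * contentOp α μ (loEntry r) * heckeOp α μ r =
      (α : k) • contentOp α μ (hiEntry r) := by
  -- Content operators are extended to all fillings, where the exchange is always defined and no
  -- case split is needed.
  let D : Fin n → Module.End k ((Fin n ≃ {c : ℕ × ℕ // c ∈ μ}) →₀ k) := fun a =>
    Finsupp.linearCombination k fun P => Finsupp.single P (ctCell α (P a).1)
  have hDs : ∀ a P, D a (Finsupp.single P 1) = ctCell α (P a).1 • Finsupp.single P (1 : k) :=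
    fun a P => by simp [D]
  have hD : ∀ a v, tabIncl k n μ (contentOp α μ a v) = D a (tabIncl k n μ v) := by
    intro a v
    suffices h : tabIncl k n μ ∘ₗ contentOp α μ a = D a ∘ₗ tabIncl k n μ from
      LinearMap.congr_fun h v
    ext1 T
    ext1
    simp only [LinearMap.comp_apply, Finsupp.lsingle_apply, contentOp, diagOp_single, map_smul,
      tabIncl_single, hDs]
  ext1 T
  ext1
  apply tabIncl_injective
  simp only [LinearMap.comp_apply, Module.End.mul_apply, LinearMap.smul_apply, map_smul,
    tabIncl_heckeOp α hα, hD, Finsupp.lsingle_apply, tabIncl_single]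
  have hab : (loEntry r).val + 1 = (hiEntry r).val := rfl
  have hne := T.ctCell_ne_of_near α hα (a := loEntry r) (b := hiEntry r)
    (by rw [Fin.lt_def]; omega) (by omega)
  have h₁ := T.bCell_mul_of_succ α hα hab
  have h₂ := mCell_mul_ctCell α hne
  have e : (Equiv.swap (loEntry r) (hiEntry r)).trans
      ((Equiv.swap (loEntry r) (hiEntry r)).trans T.pos) = T.pos :=
    Equiv.ext fun x => by simp
  simp only [cellOp, formalOp_single, map_add, map_smul, hDs, e, Equiv.trans_apply,
    Equiv.swap_apply_left, Equiv.swap_apply_right]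
  generalize Finsupp.single T.pos (1 : k) = A
  generalize Finsupp.single ((Equiv.swap (loEntry r) (hiEntry r)).trans T.pos) (1 : k) = B
  set c := (T.pos (loEntry r)).1
  set d := (T.pos (hiEntry r)).1
  linear_combination (norm := module) (ctCell α d * h₁ + mCell α c d * h₂) • A +
    bCell α c d • h₂ • B

theorem contentOp_hi (α : kˣ) (hα : n < orderOf α) (r : Fin (n - 1)) :
    contentOp α μ (hiEntry r) =
      (α : k)⁻¹ • (heckeOp α μ r * contentOp α μ (loEntry r) * heckeOp α μ r) := by
  rw [heckeOp_contentOp α hα, smul_smul, inv_mul_cancel₀ α.ne_zero, one_smul]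

/-- Induction over the entries along the generators. -/
theorem entry_induction {p : Fin n → Prop} (h0 : ∀ a : Fin n, a.val = 0 → p a)
    (h : ∀ r : Fin (n - 1), p (loEntry r) → p (hiEntry r)) (a : Fin n) : p a := by
  obtain ⟨a, ha⟩ := a
  induction a with
  | zero => exact h0 _ rfl
  | succ a ih => exact h ⟨a, by omega⟩ (ih (by omega))

theorem contentOp_mem_adjoin (α : kˣ) (hα : n < orderOf α) (a : Fin n) :
    contentOp α μ a ∈ Algebra.adjoin k (Set.range (heckeOp (n := n) α μ)) := by
  have hs : ∀ r, heckeOp α μ r ∈ Algebra.adjoin k (Set.range (heckeOp (n := n) α μ)) :=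
    fun r => Algebra.subset_adjoin ⟨r, rfl⟩
  induction a using entry_induction with
  | h0 a ha =>
    rw [contentOp_zero α a ha]
    exact Subalgebra.smul_mem _ (Subalgebra.one_mem _) _
  | h r ih =>
    rw [contentOp_hi α hα]
    exact Subalgebra.smul_mem _ (Subalgebra.mul_mem _ (Subalgebra.mul_mem _ (hs r) ih) (hs r)) _

/-- Lagrange interpolation: for each `U ≠ T` some content distinguishes them, and the product of the
normalised differences is the indicator of `T`. -/
theorem lsingle_comp_lapply_mem_adjoin (α : kˣ) (hα : n < orderOf α) (T : StdTableau n μ) :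
    Finsupp.lsingle T ∘ₗ Finsupp.lapply T ∈
      Algebra.adjoin k (Set.range (heckeOp (n := n) α μ)) := by
  classical
  have := Fintype.ofFinite (StdTableau n μ)
  set H := Algebra.adjoin k (Set.range (heckeOp (n := n) α μ))
  let S : Subalgebra k (StdTableau n μ → k) := H.comap diagHom
  have hsep : ∀ U : StdTableau n μ, U ≠ T → ∃ g ∈ S, g T = 1 ∧ g U = 0 := by
    intro U hU
    obtain ⟨a, ha⟩ : ∃ a : Fin n, ctCell α (T.pos a).1 - ctCell α (U.pos a).1 ≠ 0 := by
      by_contra! hall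
      have := StdTableau.pos_eq_of_ctCell_eq T U α hα fun a => sub_eq_zero.mp (hall a)
      exact hU (StdTableau.pos_injective (Equiv.ext fun a => Subtype.ext (this a).symm))
    let c : StdTableau n μ → k := fun X => ctCell α (X.pos a).1
    have hcS : c ∈ S := contentOp_mem_adjoin α hα a
    refine ⟨(c T - c U)⁻¹ • (c - algebraMap k _ (c U)), S.smul_mem (S.sub_mem hcS
      (S.algebraMap_mem _)) _, ?_, ?_⟩
    · exact inv_mul_cancel₀ ha
    · simp
  choose! g hgS hgT hgU using hsep
  let f : StdTableau n μ → k := ∏ U ∈ Finset.univ.erase T, g U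
  have hf : f ∈ S := S.prod_mem fun U hU => hgS U (Finset.ne_of_mem_erase hU)
  have hfT : ∀ X, f X = if X = T then 1 else 0 := by
    intro X
    simp only [f, Finset.prod_apply]
    split_ifs with h
    · rw [h]
      exact Finset.prod_eq_one fun U hU => hgT U (Finset.ne_of_mem_erase hU)
    · exact Finset.prod_eq_zero (Finset.mem_erase.mpr ⟨h, Finset.mem_univ X⟩) (hgU X h)
  have hdiag : Finsupp.lsingle T ∘ₗ Finsupp.lapply T = diagOp f := by
    refine LinearMap.ext fun v => Finsupp.ext fun X => ?_
    rw [diagOp_apply, hfT]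
    by_cases h : X = T
    · simp [h]
    · simp [h, Finsupp.single_eq_of_ne h]
  rw [hdiag]
  exact hf

/-- Vanishing means `α ct(r+1) = ct(r)`, so `r+1` is on the diagonal just below that of `r`. If
`r+1` is in a lower row, the cell under `r` holds an entry strictly between them; if in a higher
row, `r+1` is north-west of `r`. Both are impossible. -/
theorem one_add_mCoeff_ne_zero (α : kˣ) (hα : n < orderOf α) (T : StdTableau n μ) (r : Fin (n - 1))
    (hr : ¬ T.SameRow r) (hc : ¬ T.SameCol r) : 1 + mCoeff α T r ≠ 0 := by
  have hab : (loEntry r).val + 1 = (hiEntry r).val := rfl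
  have hne := T.ctCell_ne_of_near α hα (a := loEntry r) (b := hiEntry r)
    (by rw [Fin.lt_def]; omega) (by omega)
  unfold StdTableau.SameRow at hr
  unfold StdTableau.SameCol at hc
  intro h0
  have hn := T.card_eq
  have h₁ := hook_le_card (T.pos (loEntry r)).2 (T.pos (hiEntry r)).2
  have h₂ := hook_le_card (T.pos (hiEntry r)).2 (T.pos (loEntry r)).2
  have hd : ((T.pos (hiEntry r)).1.2 : ℤ) - (T.pos (hiEntry r)).1.1 + 1 =
      (T.pos (loEntry r)).1.2 - (T.pos (loEntry r)).1.1 := by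
    have hs := sub_ne_zero.mpr hne.symm
    have e : (α : k) * ctCell α (T.pos (hiEntry r)).1 = ctCell α (T.pos (loEntry r)).1 := by
      unfold mCoeff mCell at h0
      field_simp at h0
      linear_combination h0
    have hz : α ^ (((T.pos (hiEntry r)).1.2 : ℤ) - (T.pos (hiEntry r)).1.1 + 1) =
        α ^ (((T.pos (loEntry r)).1.2 : ℤ) - (T.pos (loEntry r)).1.1) := by
      apply Units.ext
      simp only [ctCell, mul_neg, neg_inj] at e
      rw [← e, zpow_add, zpow_one, Units.val_mul, mul_comm]
    have hdvd := orderOf_dvd_sub_iff_zpow_eq_zpow.mpr hz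
    have := Int.eq_zero_of_abs_lt_dvd hdvd (by rw [abs_lt]; constructor <;> omega)
    omega
  rcases lt_or_gt_of_ne hr with hlt | hlt
  · obtain ⟨b, hb⟩ := T.exists_entry
      (c := ((T.pos (loEntry r)).1.1 + 1, (T.pos (loEntry r)).1.2))
      (YoungDiagram.mem_of_le (by dsimp only; omega) (by dsimp only; omega) (T.pos (hiEntry r)).2)
    have h₃ := T.col_lt (loEntry r) b (by simp [hb]) (by simp [hb])
    have h₄ := T.lt_of_le (a := b) (b := hiEntry r) (by simp only [hb]; omega)
      (by simp only [hb]; omega)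
    have h₅ : b ≠ hiEntry r := by
      rintro rfl
      exact hc (by rw [hb])
    simp only [Fin.lt_def, Fin.le_def, ne_eq, Fin.ext_iff] at h₃ h₄ h₅
    omega
  · have := T.lt_of_le (a := hiEntry r) (b := loEntry r) (by omega) (by omega)
    rw [Fin.le_def] at this
    omega

/-- The operators of the Artin generators generate the endomorphism algebra of `V_μ`. -/
theorem adjoin_heckeOp_eq_top (α : kˣ) (hα : n < orderOf α) :
    Algebra.adjoin k (Set.range (heckeOp (n := n) α μ)) = ⊤ := by
  classical
  have := Fintype.ofFinite (StdTableau n μ)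
  have hs : ∀ r, heckeOp α μ r ∈ Algebra.adjoin k (Set.range (heckeOp (n := n) α μ)) :=
    fun r => Algebra.subset_adjoin (Set.mem_range_self r)
  set H := Algebra.adjoin k (Set.range (heckeOp (n := n) α μ))
  let E : StdTableau n μ → StdTableau n μ → Module.End k (SpechtSpace k n μ) :=
    fun T U => Finsupp.lsingle U ∘ₗ Finsupp.lapply T
  have hE : ∀ T U, E T U ∈ H := by
    intro T U
    induction StdTableau.reflTransGen_swap T U with
    | refl => exact lsingle_comp_lapply_mem_adjoin α hα T
    | @tail U X _ hUX ih =>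
      obtain ⟨r, hr, hc, rfl⟩ := hUX
      -- Subtracting the diagonal part of the generator leaves the next matrix unit, up to a nonzero
      -- factor.
      have e : E T (U.swap r hr hc) = (1 + mCoeff α U r)⁻¹ •
          (heckeOp α μ r * E T U + (-mCoeff α U r) • E T U) := by
        refine LinearMap.ext fun v => ?_
        have : heckeOp α μ r (Finsupp.single U (v T)) = mCoeff α U r • Finsupp.single U (v T) +
            (1 + mCoeff α U r) • Finsupp.single (U.swap r hr hc) (v T) := by
          rw [heckeOp, Finsupp.linearCombination_single, heckeVec, dif_neg hr, dif_neg hc]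
          simp only [smul_add, Finsupp.smul_single, smul_eq_mul, mul_comm]
        simp only [E, LinearMap.smul_apply, LinearMap.add_apply, Module.End.mul_apply,
          LinearMap.comp_apply, Finsupp.lapply_apply, Finsupp.lsingle_apply]
        rw [this, neg_smul, add_neg_cancel_comm, smul_smul,
          inv_mul_cancel₀ (one_add_mCoeff_ne_zero α hα U r hr hc), one_smul]
      rw [e]
      exact H.smul_mem (H.add_mem (H.mul_mem (hs r) ih) (H.smul_mem ih _)) _
  rw [eq_top_iff]
  intro f _
  let c : StdTableau n μ → SpechtSpace k n μ := fun T => f (Finsupp.single T (1 : k))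
  have hf : f = ∑ T, ∑ U, c T U • E T U := by
    ext1 T
    ext1
    simp only [LinearMap.comp_apply, Finsupp.lsingle_apply, LinearMap.sum_apply,
      LinearMap.smul_apply, E, Finsupp.lapply_apply]
    rw [Finset.sum_eq_single T]
    · simp only [Finsupp.single_eq_same, Finsupp.smul_single, smul_eq_mul, mul_one]
      exact (Finsupp.univ_sum_single _).symm
    · intro X _ hX
      simp [Finsupp.single_eq_of_ne hX]
    · simp
  rw [hf]
  exact H.sum_mem fun T _ => H.sum_mem fun U _ => H.smul_mem (hE T U) _

end Generation

/-! ## Isomorphisms between the restrictions -/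

/-- The braid relation says that `σ_i σ_{i+1}` conjugates `σ_i` to `σ_{i+1}`. -/
theorem BraidGroup.isConj_σ {n : ℕ} (i : Fin (n - 1)) (h0 : 0 < n - 1) :
    IsConj (σ ⟨0, h0⟩ : BraidGroup n) (σ i) := by
  obtain ⟨i, hi⟩ := i
  induction i with
  | zero => exact IsConj.refl _
  | succ i ih =>
    refine (ih (by omega)).trans (isConj_iff.mpr ⟨σ ⟨i, by omega⟩ * σ ⟨i + 1, hi⟩, ?_⟩)
    rw [mul_inv_eq_iff_eq_mul, ← mul_assoc]
    exact σ_braid ⟨i, by omega⟩ ⟨i + 1, hi⟩ rfl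

theorem quadratic_inv_sq {k A : Type*} [Field k] [Ring A] [Algebra k A] {a : k} (ha : a ≠ 0)
    {s t : A} (hs : s * s = (a - 1) • s + a • 1) (hst : s * t = 1) (hts : t * s = 1) :
    t * t = (a⁻¹ - 1) • t + a⁻¹ • 1 := by
  have h : 1 = (a - 1) • t + a • (t * t) := by
    calc 1 = t * (s * s) * t := by rw [← mul_assoc, hts, one_mul, hst]
      _ = _ := by
        rw [hs, mul_add, add_mul, mul_smul_comm, mul_smul_comm, hts, mul_one, smul_mul_assoc,
          smul_mul_assoc, one_mul]
  calc t * t = a⁻¹ • (((a - 1) • t + a • (t * t)) - (a - 1) • t) := by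
        rw [add_sub_cancel_left, smul_smul, inv_mul_cancel₀ ha, one_smul]
    _ = _ := by
      rw [← h]
      match_scalars <;> field_simp
      ring

/-- Transported by `φ`, `c t` yields a second monic quadratic relation for `s`. If the linear
coefficients differed, subtracting the two would make `s` scalar. -/
theorem sub_one_eq_of_intertwines {k V W : Type*} [Field k] [AddCommGroup V] [Module k V]
    [AddCommGroup W] [Module k W] (φ : V ≃ₗ[k] W) {s : Module.End k V} {t : Module.End k W}
    {a b c : k} (hs : s * s = (a - 1) • s + a • 1) (ht : t * t = (b - 1) • t + b • 1)
    (hns : ∀ x : k, s ≠ x • 1) (h : ∀ v, φ (s v) = c • t (φ v)) : a - 1 = c * (b - 1) := by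
  by_contra hne
  have hne' := sub_ne_zero.mpr hne
  refine hns ((a - 1 - c * (b - 1))⁻¹ * (c * c * b - a)) (LinearMap.ext fun v => ?_)
  have h₁ : s (s v) = (a - 1) • s v + a • v := LinearMap.congr_fun hs v
  have h₂ : t (t (φ v)) = (b - 1) • t (φ v) + b • φ v := LinearMap.congr_fun ht (φ v)
  have h₃ : s (s v) = (c * (b - 1)) • s v + (c * c * b) • v := by
    apply φ.injective
    simp only [h, map_add, map_smul, h₂]
    module
  have h₄ : (a - 1 - c * (b - 1)) • s v = (c * c * b - a) • v := by
    linear_combination (norm := module) h₃ - h₁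
  change s v = ((a - 1 - c * (b - 1))⁻¹ * (c * c * b - a)) • v
  rw [mul_smul, ← h₄, smul_smul, inv_mul_cancel₀ hne', one_smul]

/-! ### Recovering the shape from the restriction -/

section Hecke

variable {k : Type*} [Field k] {n : ℕ} {μ ν : YoungDiagram}

theorem val_mul_self_ne_one (hn : 2 ≤ n) (α : kˣ) (hα : n < orderOf α) :
    (α : k) * α ≠ 1 := by
  intro h
  have h₁ : α ^ 2 = 1 := Units.ext (by rw [sq]; exact h)
  have := orderOf_le_of_pow_eq_one two_pos h₁
  omega

theorem adjoin_heckeRep_resCommutator (hn : 2 ≤ n) (α : kˣ) (hα : n < orderOf α)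
    (hμ : μ.card = n) :
    Algebra.adjoin k (Set.range (heckeRep (n := n) α hα μ).resCommutator) = ⊤ := by
  have : Nonempty (StdTableau n μ) := StdTableau.nonempty_of_card hμ
  refine (heckeRep α hα μ).adjoin_resCommutator_eq_top BraidGroup.σ ⟨0, by omega⟩
    (fun i => BraidGroup.σ_mul_inv_mem_commutator i _) α.ne_zero (val_mul_self_ne_one hn α hα) ?_ ?_
  · rw [heckeRep_σ]
    exact heckeOp_sq α hα _
  · simp only [heckeRep_σ]
    exact adjoin_heckeOp_eq_top α hα

/-- The generators are conjugate, so if one were scalar all would be the same scalar and `End V`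
would reduce to scalars. A scalar rank-one operator then bounds the dimension by one. -/
theorem heckeOp_ne_smul_one (α : kˣ) (hα : n < orderOf α)
    (hμ : 1 < Module.finrank k (SpechtSpace k n μ)) (r : Fin (n - 1)) (c : k) :
    heckeOp α μ r ≠ c • 1 := by
  intro hr
  have hall : ∀ i : Fin (n - 1), heckeOp α μ i = c • 1 := by
    intro i
    have h0 : 0 < n - 1 := by have := r.2; omega
    obtain ⟨g, hg⟩ := isConj_iff.mp
      ((BraidGroup.isConj_σ r h0).symm.trans (BraidGroup.isConj_σ i h0))
    rw [← heckeRep_σ α hα, ← hg, map_mul, map_mul, heckeRep_σ, hr, mul_smul_comm, mul_one,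
      smul_mul_assoc, ← map_mul, mul_inv_cancel, map_one]
  have hbot : Algebra.adjoin k (Set.range (heckeOp (n := n) α μ)) = ⊥ := by
    rw [eq_bot_iff, Algebra.adjoin_le_iff]
    rintro _ ⟨i, rfl⟩
    rw [hall i, ← Algebra.algebraMap_eq_smul_one]
    exact Subalgebra.algebraMap_mem _ c
  rw [adjoin_heckeOp_eq_top α hα] at hbot
  have : Nontrivial (SpechtSpace k n μ) :=
    Module.nontrivial_of_finrank_pos (R := k) (by omega)
  obtain ⟨v, hv⟩ := exists_ne (0 : SpechtSpace k n μ)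
  obtain ⟨T, -⟩ := Finsupp.ne_iff.mp hv
  have hle : Module.finrank k (SpechtSpace k n μ) ≤ 1 := by
    refine finrank_le_one (Finsupp.single T (1 : k)) fun w => ?_
    have hw : (Finsupp.lapply T).smulRight w ∈ (⊥ : Subalgebra k (Module.End k _)) := by
      rw [← hbot]; trivial
    obtain ⟨x, hx⟩ := Algebra.mem_bot.mp hw
    refine ⟨x, ?_⟩
    have h := LinearMap.congr_fun hx (Finsupp.single T (1 : k))
    rwa [LinearMap.smulRight_apply, Finsupp.lapply_apply, Finsupp.single_eq_same, one_smul,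
      Module.algebraMap_end_apply] at h
  omega

/-- The target is abstract so that it covers both another `V_ν` and a dual space with rescaled
generators. -/
theorem map_contentOp_of_intertwines {W : Type*} [AddCommGroup W] [Module k W] (α : kˣ)
    (hα : n < orderOf α) (φ : SpechtSpace k n μ ≃ₗ[k] W) (t : Fin (n - 1) → Module.End k W)
    (D : Fin n → Module.End k W) (ht : ∀ r v, φ (heckeOp α μ r v) = t r (φ v))
    (h0 : ∀ a : Fin n, a.val = 0 → D a = (-1 : k) • 1)
    (hD : ∀ r, D (hiEntry r) = (α : k)⁻¹ • (t r * D (loEntry r) * t r)) (a : Fin n) :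
    ∀ v, φ (contentOp α μ a v) = D a (φ v) := by
  induction a using entry_induction with
  | h0 a ha =>
    intro v
    rw [contentOp_zero α a ha, h0 a ha]
    simp
  | h r ih =>
    intro v
    rw [contentOp_hi α hα, hD]
    simp only [LinearMap.smul_apply, Module.End.mul_apply, map_smul, ht, ih]

theorem eq_of_resCommutator_equiv (hn : 2 ≤ n) (α : kˣ) (hα : n < orderOf α) (hμ : μ.card = n)
    (hdim : 1 < Module.finrank k (SpechtSpace k n μ))
    (φ : SpechtSpace k n μ ≃ₗ[k] SpechtSpace k n ν)
    (hφ : ∀ h ∈ commutator (BraidGroup n), ∀ v,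
      φ (heckeRep α hα μ h v) = heckeRep α hα ν h (φ v)) : μ = ν := by
  have hα1 : (α : k) - 1 ≠ 0 := fun h =>
    val_mul_self_ne_one hn α hα (by linear_combination ((α : k) + 1) * h)
  have ht : ∀ r v, φ (heckeOp α μ r v) = heckeOp α ν r (φ v) := by
    intro r
    obtain ⟨c, hc⟩ := (heckeRep α hα μ).exists_smul_of_resCommutator_equiv _
      (adjoin_heckeRep_resCommutator hn α hα hμ) φ hφ (BraidGroup.σ r)
    simp only [heckeRep_σ] at hc
    have h := sub_one_eq_of_intertwines φ (heckeOp_sq α hα r) (heckeOp_sq α hα r)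
      (heckeOp_ne_smul_one α hα hdim r) hc
    have hc1 : c = 1 := mul_right_cancel₀ hα1 (by rw [← h, one_mul])
    simpa [hc1] using hc
  obtain ⟨T⟩ := StdTableau.nonempty_of_card hμ
  have hD := map_contentOp_of_intertwines α hα φ (heckeOp α ν) (contentOp α ν) ht
    (contentOp_zero α) (contentOp_hi α hα)
  -- `φ` maps the basis vector of `T` to a joint eigenvector with the contents of `T`; any `U` in
  -- its support has the same contents.
  obtain ⟨U, hU⟩ : ∃ U, φ (Finsupp.single T 1) U ≠ 0 := by
    by_contra! hall
    have h := φ.map_eq_zero_iff.mp (Finsupp.ext hall)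
    simp at h
  refine StdTableau.shape_eq_of_ctCell_eq T U α hα fun a => mul_right_cancel₀ hU ?_
  have h := DFunLike.congr_fun (hD a (Finsupp.single T 1)) U
  simpa only [contentOp, diagOp_apply, diagOp_single, map_smul, Finsupp.smul_apply,
    smul_eq_mul] using h

/-! ### Comparison with the dual representation -/

theorem ctCell_transpose (α : kˣ) (c : ℕ × ℕ) : ctCell α c.swap = (ctCell α c : k)⁻¹ := by
  have : ((c.swap.2 : ℤ) - c.swap.1) = -((c.2 : ℤ) - c.1) := by simp
  rw [ctCell, this, zpow_neg, ctCell, Units.val_inv_eq_inv_val, inv_neg]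

theorem eq_transpose_of_resCommutator_equiv_dual (hn : 2 ≤ n) (α : kˣ) (hα : n < orderOf α)
    (hμ : μ.card = n) (hdim : 1 < Module.finrank k (SpechtSpace k n μ))
    (φ : SpechtSpace k n μ ≃ₗ[k] Module.Dual k (SpechtSpace k n ν))
    (hφ : ∀ h ∈ commutator (BraidGroup n), ∀ v,
      φ (heckeRep α hα μ h v) = (heckeRep α hα ν).dual h (φ v)) : μ = ν.transpose := by
  have hα0 := α.ne_zero
  have hα1 : (α : k) - 1 ≠ 0 := fun h =>
    val_mul_self_ne_one hn α hα (by linear_combination ((α : k) + 1) * h)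
  let s' : Fin (n - 1) → Module.End k (SpechtSpace k n ν) :=
    fun r => heckeRep α hα ν (BraidGroup.σ r)⁻¹
  have hss' : ∀ r, heckeOp α ν r * s' r = 1 := fun r => by
    rw [← heckeRep_σ α hα, ← map_mul, mul_inv_cancel, map_one]
  have hs's : ∀ r, s' r * heckeOp α ν r = 1 := fun r => by
    rw [← heckeRep_σ α hα, ← map_mul, inv_mul_cancel, map_one]
  have hdual : ∀ r f, (heckeRep α hα ν).dual (BraidGroup.σ r) f = f ∘ₗ s' r := fun r f => rfl
  have hs'sq : ∀ r, s' r * s' r = ((α : k)⁻¹ - 1) • s' r + (α : k)⁻¹ • 1 := by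
    intro r
    exact quadratic_inv_sq (A := Module.End k (SpechtSpace k n ν)) hα0 (heckeOp_sq α hα r)
      (hss' r) (hs's r)
  have hdualsq : ∀ r, (heckeRep α hα ν).dual (BraidGroup.σ r) *
      (heckeRep α hα ν).dual (BraidGroup.σ r) =
      ((α : k)⁻¹ - 1) • (heckeRep α hα ν).dual (BraidGroup.σ r) + (α : k)⁻¹ • 1 := by
    intro r
    refine LinearMap.ext fun f => LinearMap.ext fun v => ?_
    have h := congrArg f (LinearMap.congr_fun (hs'sq r) v)
    simp only [Module.End.mul_apply, LinearMap.add_apply, LinearMap.smul_apply, map_add,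
      map_smul] at h
    exact h
  have ht : ∀ r v, φ (heckeOp α μ r v) =
      (-(α : k) • (heckeRep α hα ν).dual (BraidGroup.σ r)) (φ v) := by
    intro r
    obtain ⟨c, hc⟩ := (heckeRep α hα μ).exists_smul_of_resCommutator_equiv _
      (adjoin_heckeRep_resCommutator hn α hα hμ) φ hφ (BraidGroup.σ r)
    simp only [heckeRep_σ] at hc
    have h := sub_one_eq_of_intertwines φ (heckeOp_sq α hα r) (hdualsq r)
      (heckeOp_ne_smul_one α hα hdim r) hc
    -- The dual generators satisfy the quadratic relation with `α⁻¹` in place of `α`, so `α - 1 = c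
    -- (α⁻¹ - 1)`.
    have hcα : c = -(α : k) := by
      field_simp at h
      exact mul_right_cancel₀ hα1 (by linear_combination h)
    rw [← hcα]
    exact hc
  let C : Fin n → Module.End k (SpechtSpace k n ν) :=
    fun a => diagOp fun U => (ctCell α (U.pos a).1)⁻¹
  have hCC : ∀ a, contentOp α ν a * C a = 1 := fun a => by
    refine LinearMap.ext fun v => Finsupp.ext fun U => ?_
    simp [C, contentOp, diagOp_apply, mul_inv_cancel_left₀ (ctCell_ne_zero α _)]
  have hCC' : ∀ a, C a * contentOp α ν a = 1 := fun a => by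
    refine LinearMap.ext fun v => Finsupp.ext fun U => ?_
    simp [C, contentOp, diagOp_apply, inv_mul_cancel_left₀ (ctCell_ne_zero α _)]
  -- The inverse of the Jucys–Murphy recursion, obtained from uniqueness of inverses.
  have hC : ∀ r, s' r * C (loEntry r) * s' r = (α : k)⁻¹ • C (hiEntry r) := by
    intro r
    refine left_inv_eq_right_inv (a := heckeOp α ν r * contentOp α ν (loEntry r) * heckeOp α ν r)
      ?_ ?_
    · calc s' r * C (loEntry r) * s' r *
            (heckeOp α ν r * contentOp α ν (loEntry r) * heckeOp α ν r)
          = s' r * C (loEntry r) * (s' r * heckeOp α ν r) * contentOp α ν (loEntry r) *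
            heckeOp α ν r := by simp only [mul_assoc]
        _ = 1 := by rw [hs's, mul_one, mul_assoc (s' r), hCC', mul_one, hs's]
    · rw [heckeOp_contentOp α hα, smul_mul_smul_comm, hCC, mul_inv_cancel₀ hα0, one_smul]
  -- The factor `(-α)²` from the two rescaled generators cancels the `α⁻¹` of the recursion and the
  -- `α⁻¹` of `hC`.
  have hD := map_contentOp_of_intertwines α hα φ _ (fun a => (C a).dualMap) ht
    (fun a ha => by
      refine LinearMap.ext fun f => LinearMap.ext fun v => ?_
      have : C a v = -v := by
        refine Finsupp.ext fun U => ?_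
        simp [C, diagOp_apply, U.pos_zero a ha, ctCell]
      simp [this])
    (fun r => by
      refine LinearMap.ext fun f => LinearMap.ext fun v => ?_
      have h := congrArg f (LinearMap.congr_fun (hC r) v)
      simp only [Module.End.mul_apply, LinearMap.smul_apply, map_smul, smul_eq_mul] at h
      simp only [LinearMap.smul_apply, Module.End.mul_apply, hdual, LinearMap.dualMap_apply,
        LinearMap.comp_apply, map_smul, smul_eq_mul, h]
      field_simp)
  obtain ⟨T⟩ := StdTableau.nonempty_of_card hμ
  obtain ⟨U, hU⟩ : ∃ U, φ (Finsupp.single T 1) (Finsupp.single U 1) ≠ 0 := by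
    by_contra! hall
    have h0 : φ (Finsupp.single T 1) = 0 := by
      ext U
      exact hall U
    have h := φ.map_eq_zero_iff.mp h0
    simp at h
  refine StdTableau.shape_eq_of_ctCell_eq T U.transpose α hα fun a => mul_right_cancel₀ hU ?_
  have h := LinearMap.congr_fun (hD a (Finsupp.single T 1)) (Finsupp.single U 1)
  rw [StdTableau.transpose_pos, ctCell_transpose]
  simpa only [contentOp, C, diagOp_single, map_smul, LinearMap.smul_apply, smul_eq_mul,
    LinearMap.dualMap_apply] using h

end Hecke

theorem mainTheorem6 {k : Type u} [Field k] [Finite k] {n : ℕ} (hn : 2 ≤ n)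
    (α : kˣ) (hα : n < orderOf α) :
    (∀ lam : YoungDiagram, lam.card = n →
      (heckeRep α hα lam).resCommutator.IsAbsolutelyIrreducible) ∧
    (∀ lam mu : YoungDiagram, lam.card = n → mu.card = n →
      1 < Module.finrank k (SpechtSpace k n lam) →
      1 < Module.finrank k (SpechtSpace k n mu) →
      Nonempty ((heckeRep α hα lam).resCommutator.Equiv (heckeRep α hα mu).resCommutator) →
      lam = mu) ∧
    (∀ lam mu : YoungDiagram, lam.card = n → mu.card = n →
      1 < Module.finrank k (SpechtSpace k n lam) →
      1 < Module.finrank k (SpechtSpace k n mu) →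
      Nonempty ((heckeRep α hα lam).resCommutator.Equiv (heckeRep α hα mu).dual.resCommutator) →
      lam = mu.transpose) := by
  refine ⟨fun lam hlam => ?_, fun lam mu hlam _ hdim _ ⟨φ⟩ => ?_, fun lam mu hlam _ hdim _ ⟨φ⟩ => ?_⟩
  · have : Nonempty (StdTableau n lam) := StdTableau.nonempty_of_card hlam
    exact Representation.isAbsolutelyIrreducible_of_adjoin_eq_top _
      (adjoin_heckeRep_resCommutator hn α hα hlam)
  · exact eq_of_resCommutator_equiv hn α hα hlam hdim φ.toLinearEquiv
      fun h hh v => φ.toIntertwiningMap.isIntertwining _ _ ⟨h, hh⟩ v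
  · exact eq_transpose_of_resCommutator_equiv_dual hn α hα hlam hdim φ.toLinearEquiv
      fun h hh v => φ.toIntertwiningMap.isIntertwining _ _ ⟨h, hh⟩ v
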